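/- \textbf{Definitions.} A state on a unital $C^*$-algebra $\mathcal A$ is a positive linear functional $\varphi$ with $\varphi(1)=1$. The distribution of a self-adjoint $a\in\mathcal A$ with respect to $\varphi$ is the compactly supported probability measure $\mu$ on $\mathbb R$ with $\int f\,d\mu=\varphi(f(a))$ for all continuous $f$. Let $\varphi,\psi$ be states on $\mathcal A$ and $I$ a linearly ordered set. A family $(\mathcal A_i)_{i\in I}$ of (not necessarily unital) subalgebras is \emph{monotone independent} with respect to $\psi$ if $\psi(a_1\cdots a_n)=\psi(a_j)\,\psi(a_1\cdots a_{j-1}a_{j+1}\cdots a_n)$ whenever $a_k\in\mathcal A_{i_k}$ and $i_{j-1}<i_j>i_{j+1}$ (for $j=1$ or $j=n$ only the existing neighbour is considered). It is \emph{c-monotone independent} with respect to $(\varphi,\psi)$ if it is monotone independent with respect to $\psi$ and, for $a_k\in\mathcal A_{i_k}$, (i) $\varphi(a_1\cdots a_n)=\varphi(a_1)\varphi(a_2\cdots a_n)$ if $i_1>i_2$; (ii) $\varphi(a_1\cdots a_n)=\varphi(a_n)\varphi(a_1\cdots a_{n-1})$ if $i_n>i_{n-1}$; (iii) $\varphi(a_1\cdots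 a_n)=(\varphi(a_j)-\psi(a_j))\,\varphi(a_1\cdots a_{j-1})\,\varphi(a_{j+1}\cdots a_n)+\psi(a_j)\,\varphi(a_1\cdots a_{j-1}a_{j+1}\cdots a_n)$ if $2\le j\le n-1$ and $i_{j-1}<i_j>i_{j+1}$. Self-adjoint elements are c-monotone independent if the subalgebras they generate without the unit are. For a probability measure $\mu$ on $\mathbb R$ put $G_\mu(z)=\int\frac{d\mu(x)}{z-x}$ and $H_\mu(z)=1/G_\mu(z)$ for $\operatorname{Im}z>0$. For $t\ge 0$, $\mathcal U_t(\mu)$ is the unique probability measure with $H_{\mathcal U_t(\mu)}(z)=(1-t)z+tH_\mu(z)$ for $\operatorname{Im}z>0$. For $v>0$ let $\nu_v$ be the arcsine law of variance $v$, with density $\frac1{\pi\sqrt{2v-x^2}}$ on $(-\sqrt{2v},\sqrt{2v})$. For $\rho>0$ the monotone Poisson law $p_\rho$ is the unique probability measure with $H_{p_\rho}(z)=H(1,z)$ for $\operatorname{Im}z>0$, where, for $0\le t\le 1$, $H(t,z)$ stays in the upper half-plane and solves $\frac{d}{dt}H(t,z)=\frac{\rho H(t,z)}{1-H(t,z)}$,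 $H(0,z)=z$. For $p,q>0$ the Kesten distribution $K_{p,q}$ has density $\frac{p\sqrt{4q-x^2}}{2\pi(p^2-(p-q)x^2)}$ on $(-2\sqrt q,2\sqrt q)$ and, if $p>2q$, two further atoms at $\pm\frac{p}{\sqrt{p-q}}$ of mass $\frac{p-2q}{2(p-q)}$ each. \textbf{Theorem.} Let $\mathcal A$ be a unital $C^*$-algebra with two states $\varphi,\psi$. (1) Let $(X_i)_{i\ge1}$ be self-adjoint elements of $\mathcal A$, identically distributed with respect to each of $\varphi$ and $\psi$ and c-monotone independent, with $\varphi(X_i)=\psi(X_i)=0$, $\varphi(X_i^2)=\alpha^2$, $\psi(X_i^2)=\beta^2$, where $\alpha\ge0$, $\beta>0$. Then $\mathcal U_{\alpha^2/\beta^2}(\nu_{\beta^2})$ exists and is unique, and the pair of distributions of $\frac{X_1+\cdots+X_n}{\sqrt n}$ with respect to $\varphi$ and $\psi$ converges weakly to $(\mathcal U_{\alpha^2/\beta^2}(\nu_{\beta^2}),\nu_{\beta^2})$ as $n\to\infty$. If $\alpha>0$, then $\mathcal U_{\alpha^2/\beta^2}(\nu_{\beta^2})$ is the Kesten distribution $K_{\alpha^2,\beta^2/2}$.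 (2) Let $\lambda,\rho>0$ and let $X_N^{(n)}$ $(1\le n\le N<\infty)$ be self-adjoint elements of $\mathcal A$ such that for each $N$ the elements $X_N^{(1)},\dots,X_N^{(N)}$ are identically distributed with respect to each of $\varphi$ and $\psi$ and c-monotone independent, and such that $N\varphi((X_N^{(1)})^k)\to\lambda$ and $N\psi((X_N^{(1)})^k)\to\rho$ as $N\to\infty$ for all $k\ge1$. Then $p_\rho$ and $\mathcal U_{\lambda/\rho}(p_\rho)$ exist and are unique, and the pair of distributions of $X_N^{(1)}+\cdots+X_N^{(N)}$ with respect to $\varphi$ and $\psi$ converges weakly to $(\mathcal U_{\lambda/\rho}(p_\rho),p_\rho)$ as $N\to\infty$. -/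

import Mathlib

open MeasureTheory Filter Topology
open scoped CompactlySupported ComplexOrder

namespace CMonotone

section Independence

variable {A : Type*} [CStarAlgebra A] [PartialOrder A] [StarOrderedRing A]

/-- The set of all finite products `a₁ a₂ ⋯ aₙ` (`n ≥ 0`, the empty product being `1`) of elements
of the subalgebras `𝒜 i`. -/
def words {I : Type*} (𝒜 : I → NonUnitalSubalgebra ℂ A) : Submonoid A :=
  Submonoid.closure (⋃ i, (𝒜 i : Set A))

/-- Monotone independence of a family of (not necessarily unital) subalgebras: a factor `a` whose
index is strictly larger than the indices of its neighbours can be pulled out of a product. The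
three fields are the cases where `a` is an inner, the first, or the last factor. -/
structure IsMonotoneIndependent {I : Type*} [LinearOrder I] (ψ : A →ₚ[ℂ] ℂ)
    (𝒜 : I → NonUnitalSubalgebra ℂ A) : Prop where
  inner : ∀ (i j k : I) (u v x a y : A), u ∈ words 𝒜 → v ∈ words 𝒜 → x ∈ 𝒜 i → a ∈ 𝒜 j →
    y ∈ 𝒜 k → i < j → k < j → ψ (u * x * a * y * v) = ψ a * ψ (u * x * y * v)
  first : ∀ (j k : I) (v a y : A), v ∈ words 𝒜 → a ∈ 𝒜 j → y ∈ 𝒜 k → k < j →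
    ψ (a * y * v) = ψ a * ψ (y * v)
  last : ∀ (i j : I) (u x a : A), u ∈ words 𝒜 → x ∈ 𝒜 i → a ∈ 𝒜 j → i < j →
    ψ (u * x * a) = ψ a * ψ (u * x)

/-- Conditionally monotone independence of a family of (not necessarily unital) subalgebras with
respect to a pair `(φ, ψ)`. -/
structure IsCMonotoneIndependent {I : Type*} [LinearOrder I] (φ ψ : A →ₚ[ℂ] ℂ)
    (𝒜 : I → NonUnitalSubalgebra ℂ A) : Prop where
  first : ∀ (j k : I) (v a y : A), v ∈ words 𝒜 → a ∈ 𝒜 j → y ∈ 𝒜 k → k < j →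
    φ (a * y * v) = φ a * φ (y * v)
  last : ∀ (i j : I) (u x a : A), u ∈ words 𝒜 → x ∈ 𝒜 i → a ∈ 𝒜 j → i < j →
    φ (u * x * a) = φ a * φ (u * x)
  inner : ∀ (i j k : I) (u v x a y : A), u ∈ words 𝒜 → v ∈ words 𝒜 → x ∈ 𝒜 i → a ∈ 𝒜 j →
    y ∈ 𝒜 k → i < j → k < j →
    φ (u * x * a * y * v) = (φ a - ψ a) * φ (u * x) * φ (y * v) + ψ a * φ (u * x * y * v)
  monotone : IsMonotoneIndependent ψ 𝒜

/-- C-monotone independence of self-adjoint random variables: that of the subalgebras they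
generate without the unit. -/
def AreCMonotoneIndependent {I : Type*} [LinearOrder I] (φ ψ : A →ₚ[ℂ] ℂ)
    (X : I → selfAdjoint A) : Prop :=
  IsCMonotoneIndependent φ ψ fun i => NonUnitalAlgebra.adjoin ℂ {(X i : A)}

/-- All `X i` have the same distribution (that is, the same moments) with respect to `φ`. -/
def IdenticallyDistributed {I : Type*} (φ : A →ₚ[ℂ] ℂ) (X : I → selfAdjoint A) : Prop :=
  ∀ (i j : I) (k : ℕ), φ ((X i : A) ^ k) = φ ((X j : A) ^ k)

end Independence

section Law

variable {A : Type*} [CStarAlgebra A] [PartialOrder A] [StarOrderedRing A]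

/-- The positive functional `f ↦ φ (f(a))` on the continuous functions on the spectrum of `a`. -/
noncomputable def spectralFunctional (φ : A →ₚ[ℂ] ℂ) (a : selfAdjoint A) :
    C_c(spectrum ℝ (a : A), ℝ) →ₚ[ℝ] ℝ where
  toFun f := (φ (cfcHom (R := ℝ) a.2 f.toContinuousMap)).re
  map_add' f g := by
    have : (f + g).toContinuousMap = f.toContinuousMap + g.toContinuousMap := rfl
    simp [this]
  map_smul' c f := by
    have : (c • f).toContinuousMap = c • f.toContinuousMap := rfl
    rw [this, map_smul, PositiveLinearMap.map_smul_of_tower]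
    simp
  monotone' f g hfg := by
    have h : f.toContinuousMap ≤ g.toContinuousMap := fun x => hfg x
    exact (Complex.le_def.1 (OrderHomClass.mono φ (cfcHom_mono (R := ℝ) a.2 h))).1

/-- The spectral distribution of a self-adjoint element, as a measure on its spectrum. -/
noncomputable def spectralMeasure (φ : A →ₚ[ℂ] ℂ) (a : selfAdjoint A) :
    Measure (spectrum ℝ (a : A)) :=
  RealRMK.rieszMeasure (spectralFunctional φ a)

theorem isProbabilityMeasure_spectralMeasure (φ : A →ₚ[ℂ] ℂ) (hφ : φ 1 = 1)
    (a : selfAdjoint A) : IsProbabilityMeasure (spectralMeasure φ a) := by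
  have hfin : IsFiniteMeasure (spectralMeasure φ a) := by
    unfold spectralMeasure; infer_instance
  let o : C_c(spectrum ℝ (a : A), ℝ) := ⟨1, HasCompactSupport.of_compactSpace 1⟩
  have h := RealRMK.integral_rieszMeasure (spectralFunctional φ a) o
  have h1 : spectralFunctional φ a o = 1 := by
    change (φ (cfcHom (R := ℝ) a.2 1)).re = 1
    rw [map_one, hφ]; simp
  have h2 : ∫ x, o x ∂(spectralMeasure φ a) = (spectralMeasure φ a).real Set.univ := by
    change ∫ x, (1 : ℝ) ∂(spectralMeasure φ a) = _
    simp
  rw [h1] at h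
  constructor
  have h3 : (spectralMeasure φ a).real Set.univ = 1 := h2.symm.trans h
  rwa [Measure.real, ENNReal.toReal_eq_one_iff] at h3

/-- The distribution of a self-adjoint element `a` with respect to a state `φ`: the probability
measure `μ` on the real line, carried by the spectrum of `a`, with `∫ f dμ = φ (f(a))`. -/
noncomputable def law (φ : A →ₚ[ℂ] ℂ) (hφ : φ 1 = 1) (a : selfAdjoint A) :
    ProbabilityMeasure ℝ :=
  ⟨(spectralMeasure φ a).map Subtype.val,
    haveI := isProbabilityMeasure_spectralMeasure φ hφ a
    Measure.isProbabilityMeasure_map measurable_subtype_coe.aemeasurable⟩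

theorem integral_law (φ : A →ₚ[ℂ] ℂ) (hφ : φ 1 = 1) (a : selfAdjoint A) (f : ℝ → ℝ)
    (hf : Continuous f) :
    ∫ x, f x ∂(law φ hφ a : Measure ℝ) = (φ (cfc f (a : A))).re := by
  have h := RealRMK.integral_rieszMeasure (spectralFunctional φ a)
    ⟨⟨fun x => f x, by fun_prop⟩, HasCompactSupport.of_compactSpace _⟩
  change ∫ x, f x ∂((spectralMeasure φ a).map Subtype.val) = _
  rw [integral_map measurable_subtype_coe.aemeasurable hf.aestronglyMeasurable]
  refine h.trans ?_
  have ha : IsSelfAdjoint (a : A) := a.2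
  rw [cfc_apply f (a : A) ha hf.continuousOn]
  rfl

end Law

section Transforms

/-- The Cauchy transform `G_μ(z) = ∫ 1 / (z - x) dμ(x)`. -/
noncomputable def cauchyTransform (μ : ProbabilityMeasure ℝ) (z : ℂ) : ℂ :=
  ∫ x : ℝ, 1 / (z - (x : ℂ)) ∂(μ : Measure ℝ)

/-- The reciprocal Cauchy transform `H_μ(z) = 1 / G_μ(z)`. -/
noncomputable def recipCauchy (μ : ProbabilityMeasure ℝ) (z : ℂ) : ℂ :=
  1 / cauchyTransform μ z

/-- `κ = 𝒰_t(μ)`, the `t`-transform of `μ`: `H_κ(z) = (1 - t) z + t H_μ(z)` on the upper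
half-plane. -/
def IsTTransform (t : ℝ) (μ κ : ProbabilityMeasure ℝ) : Prop :=
  ∀ z : ℂ, 0 < z.im → recipCauchy κ z = (1 - t) * z + t * recipCauchy μ z

/-- `p` is the monotone Poisson distribution with parameter `ρ`: `H_p` is the time-one map of the
flow on the upper half-plane of the vector field `w ↦ ρ w / (1 - w)`. -/
def IsMonotonePoisson (ρ : ℝ) (p : ProbabilityMeasure ℝ) : Prop :=
  ∃ H : ℝ → ℂ → ℂ, ∀ z : ℂ, 0 < z.im →
    H 0 z = z ∧
    (∀ t ∈ Set.Icc (0 : ℝ) 1, 0 < (H t z).im ∧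
      HasDerivWithinAt (fun s => H s z) (ρ * H t z / (1 - H t z)) (Set.Icc 0 1) t) ∧
    H 1 z = recipCauchy p z

end Transforms

section Laws

/-- The measure with density `1 / (π √(2v - x²))` on `(-√(2v), √(2v))`. -/
noncomputable def arcsineMeasure (v : ℝ) : Measure ℝ :=
  (volume.restrict (Set.Ioo (-√(2 * v)) √(2 * v))).withDensity
    fun x => ENNReal.ofReal (1 / (Real.pi * √(2 * v - x ^ 2)))

theorem isProbabilityMeasure_arcsineMeasure {v : ℝ} (hv : 0 < v) :
    IsProbabilityMeasure (arcsineMeasure v) := by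
  set r : ℝ := √(2 * v) with hr
  have hr0 : 0 < r := Real.sqrt_pos.2 (by linarith)
  have hr2 : r ^ 2 = 2 * v := Real.sq_sqrt (by linarith)
  have hcont : ContinuousOn (fun x : ℝ => Real.arcsin (x / r) / Real.pi) (Set.Icc (-r) r) := by
    have : Continuous fun x : ℝ => Real.arcsin (x / r) / Real.pi :=
      (Real.continuous_arcsin.comp (continuous_id.div_const r)).div_const _
    exact this.continuousOn
  have hderiv : ∀ x ∈ Set.Ioo (-r) r, HasDerivAt (fun x : ℝ => Real.arcsin (x / r) / Real.pi)
      (1 / (Real.pi * √(2 * v - x ^ 2))) x := by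
    intro x hx
    have h1 : x / r ≠ -1 := by
      intro h; rw [div_eq_iff hr0.ne'] at h; linarith [hx.1]
    have h2 : x / r ≠ 1 := by
      intro h; rw [div_eq_iff hr0.ne'] at h; linarith [hx.2]
    have h3 := ((Real.hasDerivAt_arcsin h1 h2).comp x
      ((hasDerivAt_id x).div_const r)).div_const Real.pi
    refine h3.congr_deriv ?_
    have h4 : √(1 - (x / r) ^ 2) = √(2 * v - x ^ 2) / r := by
      rw [← hr2, eq_div_iff hr0.ne']
      nth_rewrite 2 [← Real.sqrt_sq hr0.le]
      rw [← Real.sqrt_mul' _ (sq_nonneg r)]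
      congr 1
      field_simp
    rw [h4]
    have h5 : √(2 * v - x ^ 2) ≠ 0 := by
      refine (Real.sqrt_pos.2 ?_).ne'
      nlinarith [hx.1, hx.2]
    have := Real.pi_ne_zero
    field_simp
  have hpos : ∀ x : ℝ, 0 ≤ 1 / (Real.pi * √(2 * v - x ^ 2)) := fun x => by positivity
  have hint := intervalIntegral.integrableOn_deriv_of_nonneg hcont hderiv fun x _ => hpos x
  have hle : -r ≤ r := by linarith
  have hval := intervalIntegral.integral_eq_sub_of_hasDerivAt_of_le hle hcont hderiv
    ((intervalIntegrable_iff_integrableOn_Ioc_of_le hle).2 hint)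
  constructor
  rw [arcsineMeasure, withDensity_apply _ MeasurableSet.univ, Measure.restrict_univ, ← hr,
    restrict_Ioo_eq_restrict_Ioc, ← ofReal_integral_eq_lintegral_ofReal hint
      (Eventually.of_forall hpos), ← intervalIntegral.integral_of_le hle, hval]
  have := Real.pi_ne_zero
  rw [neg_div, div_self hr0.ne', Real.arcsin_neg, Real.arcsin_one]
  rw [ENNReal.ofReal_eq_one]
  field_simp
  ring

/-- The (centered) arcsine law with variance `v`. -/
noncomputable def arcsineLaw (v : ℝ) (hv : 0 < v) : ProbabilityMeasure ℝ :=
  ⟨arcsineMeasure v, isProbabilityMeasure_arcsineMeasure hv⟩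

/-- The Kesten distribution with parameters `p, q > 0`, i.e. the probability measure whose Cauchy
transform is the continued fraction `1 / (z - p / (z - q / (z - q / ⋯)))`. Its absolutely
continuous part lives on `[-2√q, 2√q]`, and it has two atoms if `p > 2q`. -/
noncomputable def kestenMeasure (p q : ℝ) : Measure ℝ :=
  (volume.restrict (Set.Ioo (-(2 * √q)) (2 * √q))).withDensity
      (fun x => ENNReal.ofReal
        (p * √(4 * q - x ^ 2) / (2 * Real.pi * (p ^ 2 - (p - q) * x ^ 2)))) +
    (if 2 * q < p then
      ENNReal.ofReal ((p - 2 * q) / (2 * (p - q))) •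
        (Measure.dirac (p / √(p - q)) + Measure.dirac (-(p / √(p - q))))
    else 0)

end Laws

end CMonotone

/-!
For a self-adjoint element `b` write `F_b`, `H_b` for the reciprocal Cauchy transforms of its
distributions with respect to `φ` and `ψ`. If `a` is a sum of elements of subalgebras
whose indices are smaller than that of `b`, then

  `H_{a+b}(z) = H_a(H_b(z))`,   `F_{a+b}(z) = F_a(H_b(z)) + F_b(z) - H_b(z)`.

This is `IsCMonotoneIndependent.recipCauchy_law_add`. It is proved with resolvents instead of
moment series: the resolvents lie in the closed spans of words, so the factorisation rules extend
to them by continuity, and eliminating the peak `(z - b)⁻¹` from the resolvent equation leaves a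
linear system.

Consider a triangular array whose common law in row `N` has first moment about `γ / N` and
satisfies `N x² dμ → σ δ_s`. Then `H(w) - w` is about `V(w) / N`, where
`V(w) = -(γ + σ / (w - s))`, uniformly on half-planes `{Im w ≥ c}`
(`eventually_norm_recipCauchy_sub_le`). With respect to `ψ` the transform of a row sum is a
composition of `N` such maps, that is, an Euler scheme for the flow of `V`, and it converges to
the time-one map of this flow (`tendsto_recipCauchy_law_sum`). With respect to `φ` the
displacements `F(w) - w` add up along the same orbit; when the moments for `φ` are
asymptotically `t` times those for `ψ`, the total displacement is `t` times the one for
`ψ`, which is the `t`-transform (`tendsto_recipCauchy_law_sum_sub`). Since second moments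
stay bounded and a probability measure is determined by its Cauchy transform
(`eq_of_cauchyTransform_eq`), pointwise convergence of the transforms gives weak convergence
(`exists_tendsto_of_tendsto_cauchyTransform`).

In the central limit theorem `V(w) = -β² / w`, so `w²` is affine along the flow and the limit
transform is `√(z² - 2β²)`. It belongs to the arcsine law, whose Cauchy transform `G` satisfies
`z G + (z² - 2v) G' = 0` (`arcsineLaw_ode`). For the Kesten distribution, multiplication by the
denominator of the density reduces the Cauchy transform to that of the arcsine law
(`cauchyTransform_kestenLaw`). In the law of small numbers `V(w) = ρ w / (1 - w)`, and the flow is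
the one in the definition of the monotone Poisson law.
-/

namespace CMonotone

/-! ### The Cauchy transform -/

section CauchyTransform

open BoundedContinuousFunction

lemma sub_ofReal_ne_zero {z : ℂ} (hz : 0 < z.im) (x : ℝ) : z - (x : ℂ) ≠ 0 := fun h => by
  have := congrArg Complex.im h
  simp at this
  exact hz.ne' this

lemma im_le_norm_sub_ofReal (z : ℂ) (x : ℝ) : z.im ≤ ‖z - (x : ℂ)‖ := by
  simpa using Complex.im_le_norm (z - (x : ℂ))

lemma norm_one_div_sub_le {z : ℂ} (hz : 0 < z.im) (x : ℝ) : ‖1 / (z - (x : ℂ))‖ ≤ 1 / z.im := by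
  rw [norm_div, norm_one]
  exact one_div_le_one_div_of_le hz (im_le_norm_sub_ofReal z x)

lemma continuous_one_div_sub {z : ℂ} (hz : 0 < z.im) :
    Continuous fun x : ℝ => 1 / (z - (x : ℂ)) :=
  continuous_const.div (by fun_prop) (sub_ofReal_ne_zero hz)

/-- The kernel `x ↦ 1 / (z - x)` of the Cauchy transform, for `z` in the upper half-plane, as a
bounded continuous function. -/
noncomputable def cauchyKernel {z : ℂ} (hz : 0 < z.im) : ℝ →ᵇ ℂ :=
  BoundedContinuousFunction.ofNormedAddCommGroup (fun x : ℝ => 1 / (z - (x : ℂ)))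
    (continuous_one_div_sub hz) (1 / z.im) (norm_one_div_sub_le hz)

lemma integrable_one_div_sub_pow (μ : Measure ℝ) [IsFiniteMeasure μ] {z : ℂ} (hz : 0 < z.im)
    (k : ℕ) : Integrable (fun x : ℝ => (1 / (z - (x : ℂ))) ^ k) μ :=
  (cauchyKernel hz ^ k).integrable μ

lemma integrable_one_div_sub (μ : Measure ℝ) [IsFiniteMeasure μ] {z : ℂ} (hz : 0 < z.im) :
    Integrable (fun x : ℝ => 1 / (z - (x : ℂ))) μ :=
  (cauchyKernel hz).integrable μ

lemma im_one_div_sub (z : ℂ) (x : ℝ) :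
    (1 / (z - (x : ℂ))).im = -(z.im * ‖1 / (z - (x : ℂ))‖ ^ 2) := by
  rw [one_div, Complex.inv_im, norm_inv, inv_pow, Complex.sq_norm]
  simp
  ring

lemma im_cauchyTransform (μ : ProbabilityMeasure ℝ) {z : ℂ} (hz : 0 < z.im) :
    (cauchyTransform μ z).im = -(z.im * ∫ x : ℝ, ‖1 / (z - (x : ℂ))‖ ^ 2 ∂(μ : Measure ℝ)) := by
  have h := integral_im (𝕜 := ℂ) (integrable_one_div_sub (μ : Measure ℝ) hz)
  change ∫ x : ℝ, (1 / (z - (x : ℂ))).im ∂(μ : Measure ℝ) = (cauchyTransform μ z).im at h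
  rw [← h, ← integral_const_mul, ← integral_neg]
  simp_rw [im_one_div_sub]

lemma im_cauchyTransform_neg (μ : ProbabilityMeasure ℝ) {z : ℂ} (hz : 0 < z.im) :
    (cauchyTransform μ z).im < 0 := by
  rw [im_cauchyTransform μ hz, neg_lt_zero]
  refine mul_pos hz ((integral_pos_iff_support_of_nonneg (fun x => by positivity) ?_).2 ?_)
  · simpa using (integrable_one_div_sub_pow (μ : Measure ℝ) hz 2).norm
  · have : Function.support (fun x : ℝ => ‖1 / (z - (x : ℂ))‖ ^ 2) = Set.univ := by
      ext x
      have := sub_ofReal_ne_zero hz x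
      simp [this]
    rw [this]
    simp

lemma cauchyTransform_ne_zero (μ : ProbabilityMeasure ℝ) {z : ℂ} (hz : 0 < z.im) :
    cauchyTransform μ z ≠ 0 := fun h => by
  have := im_cauchyTransform_neg μ hz
  simp [h] at this

/-- The reciprocal Cauchy transform does not decrease the imaginary part. This is the
Cauchy–Schwarz inequality `|∫ f|² ≤ ∫ |f|²` for `f x = 1 / (z - x)`. -/
lemma im_le_im_recipCauchy (μ : ProbabilityMeasure ℝ) {z : ℂ} (hz : 0 < z.im) :
    z.im ≤ (recipCauchy μ z).im := by
  set f : ℝ → ℂ := fun x => 1 / (z - (x : ℂ)) with hf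
  have hi : Integrable (fun x => ‖f x‖) (μ : Measure ℝ) :=
    (integrable_one_div_sub (μ : Measure ℝ) hz).norm
  have hi2 : Integrable (fun x => ‖f x‖ ^ 2) (μ : Measure ℝ) := by
    simpa [hf] using (integrable_one_div_sub_pow (μ : Measure ℝ) hz 2).norm
  have hG : 0 < ‖cauchyTransform μ z‖ := norm_pos_iff.2 (cauchyTransform_ne_zero μ hz)
  have h1 : ‖cauchyTransform μ z‖ ≤ ∫ x, ‖f x‖ ∂(μ : Measure ℝ) := norm_integral_le_integral_norm _
  set m := ∫ x, ‖f x‖ ∂(μ : Measure ℝ) with hm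
  have h2 : 0 ≤ ∫ x, (‖f x‖ - m) ^ 2 ∂(μ : Measure ℝ) := integral_nonneg fun x => sq_nonneg _
  -- the variance of `‖f‖`
  have h3 : ∫ x, (‖f x‖ - m) ^ 2 ∂(μ : Measure ℝ)
      = (∫ x, ‖f x‖ ^ 2 ∂(μ : Measure ℝ)) - m ^ 2 := by
    have : ∀ x, (‖f x‖ - m) ^ 2 = ‖f x‖ ^ 2 - (2 * m * ‖f x‖ - m ^ 2) := fun x => by ring
    simp_rw [this]
    rw [integral_sub (g := fun x => 2 * m * ‖f x‖ - m ^ 2) hi2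
      ((hi.const_mul _).sub (integrable_const _)), integral_sub (hi.const_mul _)
      (integrable_const _), integral_const_mul, ← hm]
    simp
    ring
  have h4 : ‖cauchyTransform μ z‖ ^ 2 ≤ ∫ x, ‖f x‖ ^ 2 ∂(μ : Measure ℝ) := by
    nlinarith
  rw [recipCauchy, one_div, Complex.inv_im, im_cauchyTransform μ hz, neg_neg, ← Complex.sq_norm,
    le_div_iff₀ (by positivity)]
  exact mul_le_mul_of_nonneg_left h4 hz.le

lemma im_recipCauchy_pos (μ : ProbabilityMeasure ℝ) {z : ℂ} (hz : 0 < z.im) :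
    0 < (recipCauchy μ z).im :=
  hz.trans_le (im_le_im_recipCauchy μ hz)

lemma hasDerivAt_integral_one_div_sub_pow (μ : Measure ℝ) [IsFiniteMeasure μ] {z : ℂ}
    (hz : 0 < z.im) (k : ℕ) :
    HasDerivAt (fun w : ℂ => ∫ x : ℝ, (1 / (w - (x : ℂ))) ^ (k + 1) ∂μ)
      (-(k + 1) * ∫ x : ℝ, (1 / (z - (x : ℂ))) ^ (k + 2) ∂μ) z := by
  have hs : {w : ℂ | z.im / 2 < w.im} ∈ 𝓝 z :=
    (isOpen_lt continuous_const Complex.continuous_im).mem_nhds (by simp [hz])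
  have hmeas : ∀ᶠ w in 𝓝 z,
      AEStronglyMeasurable (fun x : ℝ => (1 / (w - (x : ℂ))) ^ (k + 1)) μ := by
    filter_upwards [hs] with w hw
    have hw' : 0 < w.im := (half_pos hz).trans hw
    exact (integrable_one_div_sub_pow μ hw' (k + 1)).aestronglyMeasurable
  have h := (hasDerivAt_integral_of_dominated_loc_of_deriv_le
    (F := fun (w : ℂ) (x : ℝ) => (1 / (w - (x : ℂ))) ^ (k + 1))
    (F' := fun (w : ℂ) (x : ℝ) => -(k + 1) * (1 / (w - (x : ℂ))) ^ (k + 2))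
    (bound := fun _ => (k + 1) * (1 / (z.im / 2)) ^ (k + 2)) hs hmeas
    (integrable_one_div_sub_pow μ hz (k + 1))
    ((integrable_one_div_sub_pow μ hz (k + 2)).const_mul _).aestronglyMeasurable
    (Eventually.of_forall fun x w hw => ?_) (integrable_const _)
    (Eventually.of_forall fun x w hw => ?_)).2
  · rwa [integral_const_mul] at h
  · have hw' : 0 < w.im := (half_pos hz).trans hw
    have h1 : ‖(-(k + 1) : ℂ)‖ = k + 1 := by
      rw [norm_neg]; exact_mod_cast Complex.norm_natCast (k + 1)
    rw [norm_mul, h1, norm_pow]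
    gcongr
    exact (norm_one_div_sub_le hw' x).trans
      (one_div_le_one_div_of_le (half_pos hz) (le_of_lt hw))
  · have hw' : w - (x : ℂ) ≠ 0 := sub_ofReal_ne_zero ((half_pos hz).trans hw) x
    have h1 : HasDerivAt (fun w : ℂ => w - (x : ℂ)) 1 w := (hasDerivAt_id w).sub_const _
    have h2 := ((h1.inv hw').pow (k + 1))
    simp only [one_div]
    refine h2.congr_deriv ?_
    simp
    field_simp
    ring

/-- If the powers of `1 / (z - x)` have the same integrals with respect to `μ` and `ν`, then so do
the elements of the star algebra generated by `u x = 1 + (conj z - z) / (z - x)`. As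
`u x = (conj z - x) / (z - x)` has modulus one, this algebra is spanned by the powers of `u` and
their conjugates. -/
lemma integral_eq_of_mem_adjoin {μ ν : Measure ℝ} [IsProbabilityMeasure μ]
    [IsProbabilityMeasure ν] {z : ℂ} (hz : 0 < z.im)
    (h : ∀ k : ℕ, ∫ x : ℝ, (1 / (z - (x : ℂ))) ^ k ∂μ = ∫ x : ℝ, (1 / (z - (x : ℂ))) ^ k ∂ν) :
    ∀ g ∈ StarAlgebra.adjoin ℂ {1 + (star z - z) • cauchyKernel hz},
      ∫ x, g x ∂μ = ∫ x, g x ∂ν := by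
  set d : ℂ := star z - z
  set u : ℝ →ᵇ ℂ := 1 + d • cauchyKernel hz with hu
  have hux : ∀ x : ℝ, u x = 1 + d * (1 / (z - (x : ℂ))) := fun x => rfl
  have hunit : star u * u = 1 := by
    ext x
    change star (u x) * u x = 1
    have h1 := sub_ofReal_ne_zero hz x
    have h2 : star z - (x : ℂ) ≠ 0 := by
      have h3 : star (z - (x : ℂ)) ≠ 0 := star_ne_zero.2 h1
      simpa using h3
    rw [hux]
    simp only [star_add, star_one, star_mul', star_div₀, star_sub, d,
      Complex.star_def, Complex.conj_ofReal, Complex.conj_conj] at h2 ⊢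
    field_simp
    ring
  have hunit' : u * star u = 1 := by rw [mul_comm]; exact hunit
  have hpow : ∀ k : ℕ, ∫ x, (u ^ k) x ∂μ = ∫ x, (u ^ k) x ∂ν := by
    intro k
    have key : ∀ (m : Measure ℝ) [IsProbabilityMeasure m], ∫ x, (u ^ k) x ∂m =
        ∑ j ∈ Finset.range (k + 1),
          (d ^ j * (k.choose j : ℂ)) * ∫ x : ℝ, (1 / (z - (x : ℂ))) ^ j ∂m := by
      intro m _
      have : ∀ x, (u ^ k) x = ∑ j ∈ Finset.range (k + 1),
          (d ^ j * (k.choose j : ℂ)) * (1 / (z - (x : ℂ))) ^ j := by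
        intro x
        change (u x) ^ k = _
        rw [hux, add_comm, add_pow]
        exact Finset.sum_congr rfl fun j _ => by rw [mul_pow]; ring
      simp_rw [this]
      rw [integral_finsetSum _ fun j _ => (integrable_one_div_sub_pow m hz j).const_mul _]
      simp_rw [integral_const_mul]
    rw [key, key]
    simp_rw [h]
  have hstar : ∀ k : ℕ, ∫ x, (star u ^ k) x ∂μ = ∫ x, (star u ^ k) x ∂ν := by
    intro k
    have key : ∀ (m : Measure ℝ), ∫ x, (star u ^ k) x ∂m = star (∫ x, (u ^ k) x ∂m) := by
      intro m
      rw [← star_pow]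
      exact integral_conj (f := fun x => (u ^ k) x)
    rw [key, key, hpow]
  have hmon : ∀ g ∈ Submonoid.closure ({u} ∪ star {u}), ∃ k : ℕ, g = u ^ k ∨ g = star u ^ k := by
    intro g hg
    induction hg using Submonoid.closure_induction with
    | mem x hx =>
      refine ⟨1, ?_⟩
      rcases hx with hx | hx
      · left; simpa using hx
      · right
        rw [Set.mem_star, Set.mem_singleton_iff] at hx
        rw [pow_one, ← hx, star_star]
    | one => exact ⟨0, Or.inl (pow_zero _).symm⟩
    | mul x y _ _ hx hy =>
      have cancel : ∀ i j : ℕ, ∃ k : ℕ, u ^ i * star u ^ j = u ^ k ∨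
          u ^ i * star u ^ j = star u ^ k := by
        intro i j
        rcases le_total j i with hij | hij
        · refine ⟨i - j, Or.inl ?_⟩
          obtain ⟨l, rfl⟩ := Nat.exists_eq_add_of_le hij
          rw [Nat.add_sub_cancel_left, pow_add, mul_right_comm, ← mul_pow, hunit', one_pow,
            one_mul]
        · refine ⟨j - i, Or.inr ?_⟩
          obtain ⟨l, rfl⟩ := Nat.exists_eq_add_of_le hij
          rw [Nat.add_sub_cancel_left, pow_add, ← mul_assoc, ← mul_pow, hunit', one_pow,
            one_mul]
      obtain ⟨i, hi⟩ := hx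
      obtain ⟨j, hj⟩ := hy
      rcases hi with rfl | rfl <;> rcases hj with rfl | rfl
      · exact ⟨i + j, Or.inl (pow_add _ _ _).symm⟩
      · exact cancel i j
      · rw [mul_comm]; exact cancel j i
      · exact ⟨i + j, Or.inr (pow_add _ _ _).symm⟩
  intro g hg
  have hg' : g ∈ Algebra.adjoin ℂ ({u} ∪ star {u}) := hg
  rw [← Subalgebra.mem_toSubmodule, Algebra.adjoin_eq_span] at hg'
  induction hg' using Submodule.span_induction with
  | mem x hx =>
    obtain ⟨k, rfl | rfl⟩ := hmon x hx
    · exact hpow k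
    · exact hstar k
  | zero => simp
  | add x y hx hy ihx ihy =>
    have key : ∀ (m : Measure ℝ) [IsProbabilityMeasure m], ∫ t, (x + y) t ∂m =
        (∫ t, x t ∂m) + ∫ t, y t ∂m := fun m _ => integral_add (x.integrable m) (y.integrable m)
    have e : ∀ w, w ∈ Submodule.span ℂ (Submonoid.closure ({u} ∪ star {u}) : Set (ℝ →ᵇ ℂ)) →
        w ∈ StarAlgebra.adjoin ℂ {u} := by
      intro w hw
      change w ∈ Algebra.adjoin ℂ ({u} ∪ star {u})
      rw [← Subalgebra.mem_toSubmodule, Algebra.adjoin_eq_span]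
      exact hw
    rw [key, key, ihx (e x hx), ihy (e y hy)]
  | smul c x hx ih =>
    have e : x ∈ StarAlgebra.adjoin ℂ {u} := by
      change x ∈ Algebra.adjoin ℂ ({u} ∪ star {u})
      rw [← Subalgebra.mem_toSubmodule, Algebra.adjoin_eq_span]
      exact hx
    have key : ∀ (m : Measure ℝ), ∫ t, (c • x) t ∂m = c * ∫ t, x t ∂m :=
      fun m => integral_const_mul c _
    rw [key, key, ih e]

/-- A probability measure is determined by its Cauchy transform on a half-plane `{Im z > c}`: the
derivatives of the transform at one point `z` give the integrals of all powers of `1 / (z - x)`,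
hence of a star algebra of functions that separates the points of the line. -/
theorem eq_of_cauchyTransform_eq {μ ν : ProbabilityMeasure ℝ} {c : ℝ} (hc : 0 ≤ c)
    (h : ∀ z : ℂ, c < z.im → cauchyTransform μ z = cauchyTransform ν z) : μ = ν := by
  have hk : ∀ (k : ℕ) (z : ℂ), c < z.im →
      ∫ x : ℝ, (1 / (z - (x : ℂ))) ^ (k + 1) ∂(μ : Measure ℝ)
        = ∫ x : ℝ, (1 / (z - (x : ℂ))) ^ (k + 1) ∂(ν : Measure ℝ) := by
    intro k
    induction k with
    | zero => intro z hz; simpa [cauchyTransform] using h z hz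
    | succ k ih =>
      intro z hz
      have h1 := hasDerivAt_integral_one_div_sub_pow (μ : Measure ℝ) (hc.trans_lt hz) k
      have h2 := hasDerivAt_integral_one_div_sub_pow (ν : Measure ℝ) (hc.trans_lt hz) k
      have h3 := h1.unique (h2.congr_of_eventuallyEq (by
        filter_upwards [(isOpen_lt continuous_const Complex.continuous_im).mem_nhds hz] with w hw
        exact ih w hw))
      exact mul_left_cancel₀ (neg_ne_zero.2 (Nat.cast_add_one_ne_zero k)) h3
  let z : ℂ := ⟨0, c + 1⟩
  have hzc : c < z.im := lt_add_one c
  have hz : 0 < z.im := hc.trans_lt hzc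
  apply Subtype.ext
  refine ext_of_forall_mem_subalgebra_integral_eq_of_polish (𝕜 := ℂ) (P := (μ : Measure ℝ))
    (P' := (ν : Measure ℝ)) (A := StarAlgebra.adjoin ℂ {1 + (star z - z) • cauchyKernel hz})
    ?_ (integral_eq_of_mem_adjoin hz fun k => ?_)
  · intro x y hxy
    refine ⟨_, ⟨toContinuousMapStarₐ ℂ (1 + (star z - z) • cauchyKernel hz), ⟨_,
      StarAlgebra.subset_adjoin ℂ _ rfl, rfl⟩, rfl⟩, ?_⟩
    change 1 + (star z - z) * (1 / (z - (x : ℂ))) ≠ 1 + (star z - z) * (1 / (z - (y : ℂ)))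
    intro he
    have hd : star z - z ≠ 0 := by
      intro h0
      have := congrArg Complex.im h0
      simp at this
      linarith
    have h1 := mul_left_cancel₀ hd (add_left_cancel he)
    rw [one_div, one_div, inv_inj] at h1
    exact hxy (by exact_mod_cast sub_right_injective h1)
  · cases k with
    | zero => simp
    | succ k => exact hk k z hzc

lemma eq_of_recipCauchy_eq {μ ν : ProbabilityMeasure ℝ}
    (h : ∀ z : ℂ, 0 < z.im → recipCauchy μ z = recipCauchy ν z) : μ = ν :=
  eq_of_cauchyTransform_eq le_rfl fun z hz => by
    have := h z hz
    rwa [recipCauchy, recipCauchy, one_div, one_div, inv_inj] at this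

/-- Tightness by Chebyshev's inequality. -/
lemma isTightMeasureSet_of_integral_sq_le {ι : Type*} {μ : ι → ProbabilityMeasure ℝ} {C : ℝ}
    (hi : ∀ n, Integrable (fun x : ℝ => x ^ 2) (μ n : Measure ℝ))
    (hC : ∀ n, ∫ x, x ^ 2 ∂(μ n : Measure ℝ) ≤ C) :
    IsTightMeasureSet {m : Measure ℝ | ∃ n, (μ n : Measure ℝ) = m} := by
  rw [isTightMeasureSet_iff_exists_isCompact_measure_compl_le]
  intro ε hε
  by_cases hε1 : ε = ⊤
  · exact ⟨∅, isCompact_empty, fun m _ => hε1 ▸ le_top⟩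
  have he : 0 < ε.toReal := ENNReal.toReal_pos hε.ne' hε1
  obtain ⟨r, hr⟩ : ∃ r : ℝ, 1 ≤ r ∧ C / ε.toReal ≤ r :=
    ⟨max 1 (C / ε.toReal), le_max_left _ _, le_max_right _ _⟩
  refine ⟨Metric.closedBall 0 r, isCompact_closedBall 0 r, ?_⟩
  rintro _ ⟨n, rfl⟩
  have h1 := mul_meas_ge_le_integral_of_nonneg (μ := (μ n : Measure ℝ))
    (Eventually.of_forall fun x => sq_nonneg x) (hi n) (r ^ 2)
  have h2 : (μ n : Measure ℝ).real (Metric.closedBall 0 r)ᶜ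
      ≤ (μ n : Measure ℝ).real {x : ℝ | r ^ 2 ≤ x ^ 2} := by
    refine measureReal_mono fun x hx => ?_
    simp only [Set.mem_compl_iff, Metric.mem_closedBall, dist_zero_right, Real.norm_eq_abs,
      not_le] at hx
    rw [Set.mem_ofPred_eq, sq_le_sq, abs_of_nonneg (by linarith : (0 : ℝ) ≤ r)]
    exact hx.le
  have h3 : (μ n : Measure ℝ).real (Metric.closedBall 0 r)ᶜ ≤ ε.toReal := by
    have h4 := (hC n)
    rw [div_le_iff₀ he] at hr
    have h5 : 0 ≤ (μ n : Measure ℝ).real {x : ℝ | r ^ 2 ≤ x ^ 2} := measureReal_nonneg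
    refine h2.trans ?_
    by_contra hlt
    push Not at hlt
    nlinarith [mul_lt_mul_of_pos_left hlt (by nlinarith : 0 < r ^ 2),
      mul_le_mul_of_nonneg_right (by nlinarith : r ≤ r ^ 2) he.le]
  exact (ENNReal.toReal_le_toReal (measure_ne_top _ _) hε1).1 h3

lemma tendsto_cauchyTransform {ι : Type*} {l : Filter ι} {μ : ι → ProbabilityMeasure ℝ}
    {κ : ProbabilityMeasure ℝ} (h : Tendsto μ l (𝓝 κ)) {z : ℂ} (hz : 0 < z.im) :
    Tendsto (fun n => cauchyTransform (μ n) z) l (𝓝 (cauchyTransform κ z)) :=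
  (ProbabilityMeasure.tendsto_iff_forall_integral_rclike_tendsto ℂ).1 h (cauchyKernel hz)

/-- The continuity theorem for the Cauchy transform, for a sequence with bounded second moments:
if the transforms converge pointwise, then the limit is the transform of a probability measure, to
which the sequence converges weakly. -/
theorem exists_tendsto_of_tendsto_cauchyTransform {μ : ℕ → ProbabilityMeasure ℝ} {C : ℝ}
    (hi : ∀ n, Integrable (fun x : ℝ => x ^ 2) (μ n : Measure ℝ))
    (hC : ∀ n, ∫ x, x ^ 2 ∂(μ n : Measure ℝ) ≤ C) {g : ℂ → ℂ}
    (hg : ∀ z : ℂ, 0 < z.im → Tendsto (fun n => cauchyTransform (μ n) z) atTop (𝓝 (g z))) :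
    ∃ κ : ProbabilityMeasure ℝ, (∀ z : ℂ, 0 < z.im → cauchyTransform κ z = g z) ∧
      Tendsto μ atTop (𝓝 κ) := by
  have hcomp : IsCompact (closure (Set.range μ)) := by
    refine isCompact_closure_of_isTightMeasureSet ?_
    have h := isTightMeasureSet_of_integral_sq_le hi hC
    convert h using 1
    ext m
    simp
  have hlim : ∀ U : Ultrafilter ℕ, (U : Filter ℕ) ≤ atTop → ∃ κ : ProbabilityMeasure ℝ,
      (∀ z : ℂ, 0 < z.im → cauchyTransform κ z = g z) ∧ Tendsto μ U (𝓝 κ) := by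
    intro U hU
    obtain ⟨κ, -, hκ⟩ := hcomp.ultrafilter_le_nhds (U.map μ)
      (.trans (by simp) (monotone_principal subset_closure))
    have hκ' : Tendsto μ U (𝓝 κ) := hκ
    exact ⟨κ, fun z hz => tendsto_nhds_unique (tendsto_cauchyTransform hκ' hz)
      ((hg z hz).mono_left hU), hκ'⟩
  obtain ⟨κ, hκ, -⟩ := hlim (hyperfilter ℕ) Nat.hyperfilter_le_atTop
  refine ⟨κ, hκ, (Filter.tendsto_iff_ultrafilter _ _ _).2 fun U hU => ?_⟩
  obtain ⟨κ', hκ', ht⟩ := hlim U hU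
  rwa [eq_of_cauchyTransform_eq le_rfl fun z hz => (hκ z hz).trans (hκ' z hz).symm]

end CauchyTransform

/-! ### Resolvents and distributions in a C⋆-algebra -/

section Resolvent

variable {A : Type*} [CStarAlgebra A]

lemma cfc_mem_of_isClosed {W : Submodule ℂ A} (hW : IsClosed (W : Set A)) {a : selfAdjoint A}
    (h : ∀ n : ℕ, (a : A) ^ n ∈ W) (f : ℝ → ℝ) : cfc f (a : A) ∈ W := by
  have h1 : cfc f (a : A) ∈ closure (StarAlgebra.adjoin ℝ {(a : A)} : Set A) :=
    cfc_mem_elemental f (a : A)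
  refine closure_minimal (fun x hx => ?_) hW h1
  have hs : ({(a : A)} ∪ star {(a : A)} : Set A) = {(a : A)} := by
    rw [Set.star_singleton, (show star (a : A) = a from a.2), Set.union_self]
  have hx' : x ∈ Algebra.adjoin ℝ ({(a : A)} ∪ star {(a : A)}) := hx
  rw [hs, Algebra.adjoin_singleton_eq_range_aeval] at hx'
  obtain ⟨p, rfl⟩ := hx'
  change Polynomial.aeval (a : A) p ∈ W
  rw [Polynomial.aeval_eq_sum_range]
  exact W.sum_mem fun i _ => by
    rw [← Complex.coe_smul]
    exact W.smul_mem _ (h i)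

/-- The resolvent of a self-adjoint element, in terms of the real functional calculus. -/
lemma resolvent_mul_eq_one (a : selfAdjoint A) {z : ℂ} (hz : 0 < z.im) :
    (cfc (fun x : ℝ => (1 / (z - (x : ℂ))).re) (a : A) +
        Complex.I • cfc (fun x : ℝ => (1 / (z - (x : ℂ))).im) (a : A)) *
      (algebraMap ℂ A z - a) = 1 ∧
    (algebraMap ℂ A z - a) * (cfc (fun x : ℝ => (1 / (z - (x : ℂ))).re) (a : A) +
        Complex.I • cfc (fun x : ℝ => (1 / (z - (x : ℂ))).im) (a : A)) = 1 := by
  have ha : IsSelfAdjoint (a : A) := a.2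
  have hc := continuous_one_div_sub hz
  have hp : Continuous fun x : ℝ => (1 / (z - (x : ℂ))).re := Complex.continuous_re.comp hc
  have hq : Continuous fun x : ℝ => (1 / (z - (x : ℂ))).im := Complex.continuous_im.comp hc
  set p : ℝ → ℝ := fun x => (1 / (z - (x : ℂ))).re
  set q : ℝ → ℝ := fun x => (1 / (z - (x : ℂ))).im
  have hmul : ∀ x : ℝ, (z - (x : ℂ)) * (1 / (z - (x : ℂ))) = 1 := fun x =>
    mul_one_div_cancel (sub_ofReal_ne_zero hz x)
  have h1 : ∀ x : ℝ, p x * (z.re - x) - z.im * q x = 1 := fun x => by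
    have := congrArg Complex.re (hmul x)
    simp only [Complex.mul_re, Complex.sub_re, Complex.ofReal_re, Complex.sub_im,
      Complex.ofReal_im, sub_zero, Complex.one_re] at this
    change (z.re - x) * p x - z.im * q x = 1 at this
    linarith
  have h2 : ∀ x : ℝ, q x * (z.re - x) + z.im * p x = 0 := fun x => by
    have := congrArg Complex.im (hmul x)
    simp only [Complex.mul_im, Complex.sub_re, Complex.ofReal_re, Complex.sub_im,
      Complex.ofReal_im, sub_zero, Complex.one_im] at this
    change (z.re - x) * q x + z.im * p x = 0 at this
    linarith
  have hz' : algebraMap ℂ A z - a = (z.re • (1 : A) - a) + Complex.I • (z.im • (1 : A)) := by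
    nth_rewrite 1 [← Complex.re_add_im z]
    rw [Algebra.algebraMap_eq_smul_one, add_smul, mul_comm, mul_smul, Complex.coe_smul,
      Complex.coe_smul]
    abel
  have hs : cfc (fun x : ℝ => z.re - x) (a : A) = z.re • (1 : A) - a := by
    rw [cfc_sub (fun _ => z.re) (fun x => x) (a : A) (by fun_prop) (by fun_prop),
      cfc_const z.re (a : A) ha, cfc_id' ℝ (a : A) ha, Algebra.algebraMap_eq_smul_one]
  have e1 : cfc p (a : A) * (z.re • (1 : A) - a) - z.im • cfc q (a : A) = 1 := by
    rw [← hs, ← cfc_mul p _ (a : A) hp.continuousOn (by fun_prop), ← cfc_const_mul z.im q (a : A)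
      hq.continuousOn, ← cfc_sub _ _ (a : A) (by fun_prop) (by fun_prop)]
    simp_rw [h1]
    exact cfc_const_one ℝ (a : A) ha
  have e2 : cfc q (a : A) * (z.re • (1 : A) - a) + z.im • cfc p (a : A) = 0 := by
    rw [← hs, ← cfc_mul q _ (a : A) hq.continuousOn (by fun_prop), ← cfc_const_mul z.im p (a : A)
      hp.continuousOn, ← cfc_add (a : A) _ _ (by fun_prop) (by fun_prop)]
    simp_rw [h2]
    exact cfc_const_zero ℝ (a : A)
  have c1 : Commute (cfc p (a : A)) (z.re • (1 : A) - a) := by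
    rw [← hs]; exact cfc_commute_cfc _ _ _
  have c2 : Commute (cfc q (a : A)) (z.re • (1 : A) - a) := by
    rw [← hs]; exact cfc_commute_cfc _ _ _
  have main : (cfc p (a : A) + Complex.I • cfc q (a : A)) * (algebraMap ℂ A z - a) =
      (cfc p (a : A) * (z.re • (1 : A) - a) - z.im • cfc q (a : A)) +
      Complex.I • (cfc q (a : A) * (z.re • (1 : A) - a) + z.im • cfc p (a : A)) := by
    have hI : Complex.I • z.im • Complex.I • cfc q (a : A) = -(z.im • cfc q (a : A)) := by
      rw [smul_comm z.im, smul_smul, Complex.I_mul_I, neg_one_smul]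
    rw [hz', mul_add, add_mul, add_mul]
    simp only [mul_smul_comm, smul_mul_assoc, mul_one, smul_add]
    rw [hI]
    abel
  have hcomm : Commute (cfc p (a : A) + Complex.I • cfc q (a : A)) (algebraMap ℂ A z - a) := by
    rw [hz']
    refine Commute.add_left (c1.add_right ?_) ((c2.smul_left _).add_right ?_)
    · exact ((Commute.one_right _).smul_right _).smul_right _
    · exact ((Commute.one_right _).smul_right _).smul_right _
  have e : (cfc p (a : A) + Complex.I • cfc q (a : A)) * (algebraMap ℂ A z - a) = 1 := by
    rw [main, e1, e2, smul_zero, add_zero]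
  exact ⟨e, hcomm.eq ▸ e⟩

lemma isUnit_algebraMap_sub (a : selfAdjoint A) {z : ℂ} (hz : 0 < z.im) :
    IsUnit (algebraMap ℂ A z - a) :=
  ⟨⟨_, _, (resolvent_mul_eq_one a hz).2, (resolvent_mul_eq_one a hz).1⟩, rfl⟩

lemma resolvent_mul_sub (a : selfAdjoint A) {z : ℂ} (hz : 0 < z.im) :
    resolvent (a : A) z * (algebraMap ℂ A z - a) = 1 :=
  Ring.inverse_mul_cancel _ (isUnit_algebraMap_sub a hz)

lemma sub_mul_resolvent (a : selfAdjoint A) {z : ℂ} (hz : 0 < z.im) :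
    (algebraMap ℂ A z - a) * resolvent (a : A) z = 1 :=
  Ring.mul_inverse_cancel _ (isUnit_algebraMap_sub a hz)

lemma resolvent_eq_cfc (a : selfAdjoint A) {z : ℂ} (hz : 0 < z.im) :
    resolvent (a : A) z = cfc (fun x : ℝ => (1 / (z - (x : ℂ))).re) (a : A) +
      Complex.I • cfc (fun x : ℝ => (1 / (z - (x : ℂ))).im) (a : A) :=
  left_inv_eq_right_inv (resolvent_mul_sub a hz) (resolvent_mul_eq_one a hz).2

lemma resolvent_mem_of_isClosed {W : Submodule ℂ A} (hW : IsClosed (W : Set A))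
    {a : selfAdjoint A} (h : ∀ n : ℕ, (a : A) ^ n ∈ W) {z : ℂ} (hz : 0 < z.im) :
    resolvent (a : A) z ∈ W := by
  rw [resolvent_eq_cfc a hz]
  exact W.add_mem (cfc_mem_of_isClosed hW h _) (W.smul_mem _ (cfc_mem_of_isClosed hW h _))

variable [PartialOrder A] [StarOrderedRing A]

lemma ofReal_re_apply_of_isSelfAdjoint (φ : A →ₚ[ℂ] ℂ) {x : A} (hx : IsSelfAdjoint x) :
    ((φ x).re : ℂ) = φ x :=
  Complex.conj_eq_iff_re.1 (hx.map' φ)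

lemma integrable_law (φ : A →ₚ[ℂ] ℂ) (hφ : φ 1 = 1) (a : selfAdjoint A) {f : ℝ → ℝ}
    (hf : Continuous f) : Integrable f (law φ hφ a : Measure ℝ) := by
  have := isProbabilityMeasure_spectralMeasure φ hφ a
  change Integrable f ((spectralMeasure φ a).map Subtype.val)
  rw [integrable_map_measure hf.aestronglyMeasurable measurable_subtype_coe.aemeasurable]
  let g : BoundedContinuousFunction (spectrum ℝ (a : A)) ℝ :=
    BoundedContinuousFunction.mkOfCompact ⟨fun x => f x, by fun_prop⟩
  exact g.integrable _

lemma integral_pow_law (φ : A →ₚ[ℂ] ℂ) (hφ : φ 1 = 1) (a : selfAdjoint A) (k : ℕ) :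
    ∫ x, x ^ k ∂(law φ hφ a : Measure ℝ) = (φ ((a : A) ^ k)).re := by
  rw [integral_law φ hφ a _ (by fun_prop)]
  exact congrArg (fun x => (φ x).re) (cfc_pow_id (R := ℝ) (a : A) k a.2)

lemma cauchyTransform_law (φ : A →ₚ[ℂ] ℂ) (hφ : φ 1 = 1) (a : selfAdjoint A) {z : ℂ}
    (hz : 0 < z.im) : cauchyTransform (law φ hφ a) z = φ (resolvent (a : A) z) := by
  have hc := continuous_one_div_sub hz
  have h := integral_re_add_im (𝕜 := ℂ)
    (integrable_one_div_sub (law φ hφ a : Measure ℝ) hz)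
  change ((∫ x : ℝ, (1 / (z - (x : ℂ))).re ∂(law φ hφ a : Measure ℝ) : ℝ) : ℂ) +
    ((∫ x : ℝ, (1 / (z - (x : ℂ))).im ∂(law φ hφ a : Measure ℝ) : ℝ) : ℂ) * Complex.I =
    cauchyTransform (law φ hφ a) z at h
  rw [integral_law φ hφ a (fun x => (1 / (z - (x : ℂ))).re) (Complex.continuous_re.comp hc),
    integral_law φ hφ a (fun x => (1 / (z - (x : ℂ))).im) (Complex.continuous_im.comp hc),
    ofReal_re_apply_of_isSelfAdjoint φ (cfc_predicate _ _),
    ofReal_re_apply_of_isSelfAdjoint φ (cfc_predicate _ _)] at h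
  rw [← h, resolvent_eq_cfc a hz, map_add, map_smul, smul_eq_mul, mul_comm]

end Resolvent

/-! ### Additive convolution of c-monotone independent elements -/

section Convolution

variable {A : Type*} [CStarAlgebra A]

lemma eq_of_mem_closure_span {s : Set A} {x : A}
    (hx : x ∈ (Submodule.span ℂ s).topologicalClosure) (L₁ L₂ : A →L[ℂ] ℂ)
    (h : ∀ y ∈ s, L₁ y = L₂ y) : L₁ x = L₂ x :=
  ContinuousLinearMap.eqOn_closure_span (f := L₁) (g := L₂) h hx

variable {I : Type*} {𝒜 : I → NonUnitalSubalgebra ℂ A}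

lemma span_words (𝒜 : I → NonUnitalSubalgebra ℂ A) :
    Submodule.span ℂ (words 𝒜 : Set A) =
      Subalgebra.toSubmodule (Algebra.adjoin ℂ (⋃ i, (𝒜 i : Set A))) :=
  (Algebra.adjoin_eq_span ℂ _).symm

lemma pow_mem_span_words {c : A} (hc : c ∈ Submodule.span ℂ (words 𝒜 : Set A)) (n : ℕ) :
    c ^ n ∈ Submodule.span ℂ (words 𝒜 : Set A) := by
  rw [span_words] at hc ⊢
  exact (Algebra.adjoin ℂ (⋃ i, (𝒜 i : Set A))).pow_mem hc n

lemma pow_mem_span_one_union {k : I} {b : A} (hb : b ∈ 𝒜 k) (n : ℕ) :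
    b ^ n ∈ Submodule.span ℂ ({1} ∪ (𝒜 k : Set A)) := by
  refine Submodule.subset_span ?_
  cases n with
  | zero => exact Or.inl (pow_zero b)
  | succ n =>
    refine Or.inr ?_
    induction n with
    | zero => simpa using hb
    | succ n ih => rw [pow_succ]; exact (𝒜 k).mul_mem ih hb

variable [LinearOrder I]

/-- Products of words ending in a letter of index below `k`, and the unit. -/
def lowerWords (𝒜 : I → NonUnitalSubalgebra ℂ A) (k : I) : Set A :=
  {1} ∪ {w | ∃ u ∈ words 𝒜, ∃ i < k, ∃ x ∈ 𝒜 i, w = u * x}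

/-- The elements of the subalgebras of index below `k`. -/
def lowerLetters (𝒜 : I → NonUnitalSubalgebra ℂ A) (k : I) : Set A :=
  {x | ∃ i < k, x ∈ 𝒜 i}

lemma span_lowerLetters_le (𝒜 : I → NonUnitalSubalgebra ℂ A) (k : I) :
    Submodule.span ℂ (lowerLetters 𝒜 k) ≤ Submodule.span ℂ (words 𝒜 : Set A) :=
  Submodule.span_mono fun _ ⟨i, _, hx⟩ =>
    Submonoid.subset_closure (Set.mem_iUnion.2 ⟨i, hx⟩)

lemma pow_mem_span_lowerWords {k : I} {a : A}
    (ha : a ∈ Submodule.span ℂ (lowerLetters 𝒜 k)) (n : ℕ) :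
    a ^ n ∈ Submodule.span ℂ (lowerWords 𝒜 k) := by
  cases n with
  | zero => exact Submodule.subset_span (Or.inl (pow_zero a))
  | succ n =>
    rw [pow_succ]
    have h := Submodule.mul_mem_mul (pow_mem_span_words (span_lowerLetters_le 𝒜 k ha) n) ha
    rw [Submodule.span_mul_span] at h
    refine Submodule.span_mono ?_ h
    rintro _ ⟨u, hu, x, ⟨i, hi, hx⟩, rfl⟩
    exact Or.inr ⟨u, hu, i, hi, x, hx, rfl⟩

variable [PartialOrder A]

variable {φ ψ : A →ₚ[ℂ] ℂ}

/-- Monotone independence is c-monotone independence with respect to `(ψ, ψ)`. -/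
lemma IsMonotoneIndependent.isCMonotoneIndependent (h : IsMonotoneIndependent ψ 𝒜) :
    IsCMonotoneIndependent ψ ψ 𝒜 where
  first := h.first
  last := h.last
  inner i j k u v x a y hu hv hx ha hy hij hkj := by
    rw [h.inner i j k u v x a y hu hv hx ha hy hij hkj]; ring
  monotone := h

lemma IsCMonotoneIndependent.apply_mul (h : IsCMonotoneIndependent φ ψ 𝒜) {i j : I}
    (hij : i ≠ j) {x y : A} (hx : x ∈ 𝒜 i) (hy : y ∈ 𝒜 j) : φ (x * y) = φ x * φ y := by
  rcases hij.lt_or_gt with hlt | hlt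
  · have := h.last i j 1 x y (one_mem _) hx hy hlt
    rw [one_mul] at this
    rw [this, mul_comm]
  · have := h.first i j 1 x y (one_mem _) hx hy hlt
    rwa [mul_one, mul_one] at this

variable [StarOrderedRing A]

/-- A positive functional as a continuous linear map. -/
noncomputable def toCLM (φ : A →ₚ[ℂ] ℂ) : A →L[ℂ] ℂ :=
  ⟨(φ : A →ₗ[ℂ] ℂ), map_continuous φ⟩

lemma toCLM_apply (φ : A →ₚ[ℂ] ℂ) (x : A) : toCLM φ x = φ x := rfl

/-- The continuous linear map `x ↦ φ (u * x * v)`. -/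
noncomputable def sandwich (φ : A →ₚ[ℂ] ℂ) (u v : A) : A →L[ℂ] ℂ :=
  toCLM φ ∘L (ContinuousLinearMap.mul ℂ A u) ∘L ((ContinuousLinearMap.mul ℂ A).flip v)

lemma sandwich_apply (φ : A →ₚ[ℂ] ℂ) (u v x : A) : sandwich φ u v x = φ (u * x * v) := by
  rw [mul_assoc]; rfl

/-- The factorisation rules for a peak `R` that may have a component along the unit. -/
lemma IsCMonotoneIndependent.apply_mul_peak_mul (h : IsCMonotoneIndependent φ ψ 𝒜)
    (hφ : φ 1 = 1) (hψ : ψ 1 = 1) {k : I} {y R a v : A}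
    (hy : y ∈ (Submodule.span ℂ (lowerWords 𝒜 k)).topologicalClosure)
    (hR : R ∈ (Submodule.span ℂ ({1} ∪ (𝒜 k : Set A))).topologicalClosure)
    (ha : a ∈ (Submodule.span ℂ (lowerLetters 𝒜 k)).topologicalClosure)
    (hv : v ∈ (Submodule.span ℂ (words 𝒜 : Set A)).topologicalClosure) :
    φ (y * R * a * v) = ψ R * φ (y * a * v) + (φ R - ψ R) * φ y * φ (a * v) := by
  -- all four variables are replaced by generators, as both sides are linear and continuous in each
  have hv' := eq_of_mem_closure_span hv (sandwich φ (y * R * a) 1)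
    (ψ R • sandwich φ (y * a) 1 + ((φ R - ψ R) * φ y) • sandwich φ a 1) fun v hv => ?_
  · simpa [sandwich_apply] using hv'
  simp only [add_apply, smul_apply, sandwich_apply,
    smul_eq_mul, mul_one]
  have ha' := eq_of_mem_closure_span ha (sandwich φ (y * R) v)
    (ψ R • sandwich φ y v + ((φ R - ψ R) * φ y) • sandwich φ 1 v) fun a ha => ?_
  · simpa [sandwich_apply] using ha'
  simp only [add_apply, smul_apply, sandwich_apply,
    smul_eq_mul, one_mul]
  have hy' := eq_of_mem_closure_span hy (sandwich φ 1 (R * a * v))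
    (ψ R • sandwich φ 1 (a * v) + ((φ R - ψ R) * φ (a * v)) • toCLM φ) fun y hy => ?_
  · simp only [add_apply, smul_apply, sandwich_apply,
      smul_eq_mul, one_mul, toCLM_apply] at hy'
    simp only [mul_assoc] at hy' ⊢
    rw [hy']
    ring
  simp only [add_apply, smul_apply, sandwich_apply,
    smul_eq_mul, one_mul, toCLM_apply]
  have hR' := eq_of_mem_closure_span hR (sandwich φ y (a * v))
    (φ (y * (a * v)) • toCLM ψ + (φ (a * v) * φ y) • (toCLM φ - toCLM ψ)) fun R hR => ?_
  · simp only [add_apply, smul_apply, sandwich_apply,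
      smul_eq_mul, toCLM_apply, sub_apply] at hR'
    simp only [mul_assoc] at hR' ⊢
    rw [hR']
    ring
  simp only [add_apply, smul_apply, sandwich_apply,
    smul_eq_mul, toCLM_apply, sub_apply]
  obtain ⟨j, hj, haj⟩ := ha
  rcases hR with rfl | hR
  · simp [hφ, hψ]
  rcases hy with rfl | ⟨u, hu, i, hi, x, hx, rfl⟩
  · have := h.first k j v R a hv hR haj hj
    simp only [mul_assoc, one_mul] at this ⊢
    rw [this, hφ]
    ring
  · have := h.inner i k j u v x R a hu hv hx hR haj hi hj
    simp only [mul_assoc] at this ⊢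
    rw [this]
    ring

lemma IsCMonotoneIndependent.apply_mul_peak (h : IsCMonotoneIndependent φ ψ 𝒜)
    (hφ : φ 1 = 1) {k : I} {y R : A}
    (hy : y ∈ (Submodule.span ℂ (lowerWords 𝒜 k)).topologicalClosure)
    (hR : R ∈ (Submodule.span ℂ ({1} ∪ (𝒜 k : Set A))).topologicalClosure) :
    φ (y * R) = φ R * φ y := by
  have hy' := eq_of_mem_closure_span hy (sandwich φ 1 R) (φ R • toCLM φ) fun y hy => ?_
  · simpa [sandwich_apply, toCLM_apply] using hy'
  simp only [smul_apply, sandwich_apply, smul_eq_mul, one_mul, toCLM_apply]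
  have hR' := eq_of_mem_closure_span hR (sandwich φ y 1) (φ y • toCLM φ) fun R hR => ?_
  · simpa [sandwich_apply, toCLM_apply, mul_comm] using hR'
  simp only [smul_apply, sandwich_apply, smul_eq_mul, mul_one, toCLM_apply]
  rcases hR with rfl | hR
  · simp [hφ]
  rcases hy with rfl | ⟨u, hu, i, hi, x, hx, rfl⟩
  · simp [hφ]
  · rw [h.last i k u x R hu hx hR hi, mul_comm]

/-- The additive c-monotone convolution in terms of reciprocal Cauchy transforms. With
`R = (z - b)⁻¹`, `T = (z - a - b)⁻¹`, `h = 1 / ψ(R)` and `W = (h - a)⁻¹`, the peak `R` is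
eliminated from `W T = W R + W R a T` and from `T = R + R a T`; this leaves two linear equations
for `φ(T)` and `φ(a T)`. -/
theorem IsCMonotoneIndependent.recipCauchy_law_add (h : IsCMonotoneIndependent φ ψ 𝒜)
    (hφ : φ 1 = 1) (hψ : ψ 1 = 1) {k : I} {a b : selfAdjoint A}
    (ha : (a : A) ∈ Submodule.span ℂ (lowerLetters 𝒜 k)) (hb : (b : A) ∈ 𝒜 k) {z : ℂ}
    (hz : 0 < z.im) :
    recipCauchy (law φ hφ (a + b)) z =
      recipCauchy (law φ hφ a) (recipCauchy (law ψ hψ b) z) +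
        (recipCauchy (law φ hφ b) z - recipCauchy (law ψ hψ b) z) := by
  set w := recipCauchy (law ψ hψ b) z with hw
  have hwz : 0 < w.im := im_recipCauchy_pos _ hz
  have hT0 := cauchyTransform_ne_zero (law φ hφ (a + b)) hz
  have hW0 := cauchyTransform_ne_zero (law φ hφ a) hwz
  have hR0 := cauchyTransform_ne_zero (law φ hφ b) hz
  have hg0 := cauchyTransform_ne_zero (law ψ hψ b) hz
  rw [recipCauchy] at hw
  simp only [recipCauchy]
  rw [cauchyTransform_law _ _ _ hz] at hT0 hR0 hg0 hw
  rw [cauchyTransform_law _ _ _ hwz] at hW0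
  rw [cauchyTransform_law _ _ _ hz, cauchyTransform_law _ _ _ hz, cauchyTransform_law _ _ _ hwz]
  set R := resolvent (b : A) z with hRdef
  set T := resolvent ((a + b : selfAdjoint A) : A) z with hTdef
  set W := resolvent (a : A) w with hWdef
  have hRm : R ∈ (Submodule.span ℂ ({1} ∪ (𝒜 k : Set A))).topologicalClosure :=
    resolvent_mem_of_isClosed (Submodule.isClosed_topologicalClosure _)
      (fun n => Submodule.le_topologicalClosure _ (pow_mem_span_one_union hb n)) hz
  have hWm : W ∈ (Submodule.span ℂ (lowerWords 𝒜 k)).topologicalClosure :=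
    resolvent_mem_of_isClosed (Submodule.isClosed_topologicalClosure _)
      (fun n => Submodule.le_topologicalClosure _ (pow_mem_span_lowerWords ha n)) hwz
  have h1m : (1 : A) ∈ (Submodule.span ℂ (lowerWords 𝒜 k)).topologicalClosure :=
    Submodule.le_topologicalClosure _ (Submodule.subset_span (Or.inl rfl))
  have ham : (a : A) ∈ (Submodule.span ℂ (lowerLetters 𝒜 k)).topologicalClosure :=
    Submodule.le_topologicalClosure _ ha
  have hTm : T ∈ (Submodule.span ℂ (words 𝒜 : Set A)).topologicalClosure := by
    refine resolvent_mem_of_isClosed (Submodule.isClosed_topologicalClosure _)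
      (fun n => Submodule.le_topologicalClosure _ (pow_mem_span_words ?_ n)) hz
    exact add_mem (span_lowerLetters_le 𝒜 k ha) (Submodule.subset_span
      (Submonoid.subset_closure (Set.mem_iUnion.2 ⟨k, hb⟩)))
  -- the resolvent equation
  have hRT : T = R + R * a * T := by
    have h1 : R * (algebraMap ℂ A z - b) = 1 := resolvent_mul_sub b hz
    have h2 : (algebraMap ℂ A z - ((a + b : selfAdjoint A) : A)) * T = 1 :=
      sub_mul_resolvent (a + b) hz
    have h3 : (algebraMap ℂ A z - (b : A)) * T = 1 + a * T := by
      have : algebraMap ℂ A z - (b : A) =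
          (algebraMap ℂ A z - ((a + b : selfAdjoint A) : A)) + a := by
        rw [AddSubgroup.coe_add]; abel
      rw [this, add_mul, h2]
    calc T = R * (algebraMap ℂ A z - b) * T := by rw [h1, one_mul]
      _ = R + R * a * T := by rw [mul_assoc, h3, mul_add, mul_one, mul_assoc]
  have hWa : W * a = w • W - 1 := by
    have h1 : W * (algebraMap ℂ A w - a) = 1 := resolvent_mul_sub a hwz
    rw [mul_sub, ← Algebra.commutes, ← Algebra.smul_def] at h1
    rw [← h1]; abel
  have E1 : φ T = φ R + φ R * φ (a * T) := by
    have e1 := h.apply_mul_peak_mul hφ hψ h1m hRm ham hTm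
    have e2 : φ T = φ R + φ (R * a * T) := by rw [← map_add, ← hRT]
    simp only [one_mul, hφ] at e1
    rw [e2, e1]
    ring
  have E2 : φ (W * T) = φ R * φ W + (ψ R * φ (W * a * T) + (φ R - ψ R) * φ W * φ (a * T)) := by
    have e1 := h.apply_mul_peak_mul hφ hψ hWm hRm ham hTm
    have e2 := h.apply_mul_peak hφ hWm hRm
    have e3 : φ (W * T) = φ (W * R) + φ (W * R * a * T) := by
      rw [← map_add]
      congr 1
      nth_rewrite 1 [hRT]
      rw [mul_add]
      simp only [mul_assoc]
    rw [e3, e1, e2]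
  have E3 : φ (W * a * T) = w * φ (W * T) - φ T := by
    rw [hWa, sub_mul, one_mul, smul_mul_assoc, map_sub, map_smul, smul_eq_mul]
  have hgw : ψ R * w = 1 := by rw [hw]; field_simp
  have E4 : ψ R * φ T = φ W * (φ R + (φ R - ψ R) * φ (a * T)) := by
    rw [E3] at E2
    linear_combination E2 + φ (W * T) * hgw
  have hw' : w = 1 / ψ R := hw
  have E5 : φ (a * T) = φ T / φ R - 1 := by
    field_simp
    linear_combination -E1
  rw [E5] at E4
  rw [hw']
  field_simp at E4 ⊢
  linear_combination -E4

end Convolution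

/-! ### Reciprocal Cauchy transforms of infinitesimal arrays -/

section Expansion

/-- The vector field `w ↦ -(γ + σ / (w - s))`, which generates the limiting flow of an
infinitesimal array whose rescaled first moments tend to `γ` and whose rescaled measures
`x² dμ` tend to `σ δ_s`. -/
noncomputable def driftField (γ σ s : ℝ) (w : ℂ) : ℂ := -(γ + σ / (w - s))

lemma driftField_mul (t γ σ s : ℝ) (w : ℂ) :
    driftField (t * γ) (t * σ) s w = t * driftField γ σ s w := by
  simp only [driftField]
  push_cast
  ring

lemma norm_one_div_sub_le_of_le {c : ℝ} (hc : 0 < c) {w : ℂ} (hw : c ≤ w.im) (x : ℝ) :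
    ‖1 / (w - (x : ℂ))‖ ≤ 1 / c :=
  (norm_one_div_sub_le (hc.trans_le hw) x).trans (one_div_le_one_div_of_le hc hw)

lemma norm_driftField_le (γ : ℝ) {σ : ℝ} (s : ℝ) (hσ : 0 ≤ σ) {c : ℝ} (hc : 0 < c) {w : ℂ}
    (hw : c ≤ w.im) : ‖driftField γ σ s w‖ ≤ |γ| + σ / c := by
  rw [driftField, norm_neg, div_eq_mul_one_div (σ : ℂ), div_eq_mul_one_div σ]
  refine (norm_add_le _ _).trans ?_
  rw [norm_mul, Complex.norm_real, Complex.norm_real, Real.norm_eq_abs, Real.norm_eq_abs,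
    abs_of_nonneg hσ]
  gcongr
  exact norm_one_div_sub_le_of_le hc hw s

lemma one_div_sub_sub_one_div_sub {w w' : ℂ} {x y : ℂ} (h : w - x ≠ 0) (h' : w' - y ≠ 0) :
    1 / (w - x) - 1 / (w' - y) = ((w' - w) + (x - y)) * (1 / (w - x)) * (1 / (w' - y)) := by
  field_simp
  ring

lemma norm_driftField_sub_le (γ : ℝ) {σ : ℝ} (s : ℝ) (hσ : 0 ≤ σ) {c : ℝ} (hc : 0 < c)
    {w w' : ℂ} (hw : c ≤ w.im) (hw' : c ≤ w'.im) :
    ‖driftField γ σ s w - driftField γ σ s w'‖ ≤ σ / c ^ 2 * ‖w - w'‖ := by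
  have e : driftField γ σ s w - driftField γ σ s w'
      = σ * (1 / (w' - (s : ℂ)) - 1 / (w - (s : ℂ))) := by
    simp only [driftField]; ring
  rw [e, one_div_sub_sub_one_div_sub (sub_ofReal_ne_zero (hc.trans_le hw') s)
    (sub_ofReal_ne_zero (hc.trans_le hw) s), sub_self, add_zero]
  simp only [norm_mul, Complex.norm_real, Real.norm_eq_abs, abs_of_nonneg hσ]
  calc σ * (‖w - w'‖ * ‖1 / (w' - (s : ℂ))‖ * ‖1 / (w - (s : ℂ))‖)
      ≤ σ * (‖w - w'‖ * (1 / c) * (1 / c)) := by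
        gcongr
        · exact norm_one_div_sub_le_of_le hc hw' s
        · exact norm_one_div_sub_le_of_le hc hw s
    _ = σ / c ^ 2 * ‖w - w'‖ := by field_simp

lemma im_driftField_nonneg (γ : ℝ) {σ : ℝ} (s : ℝ) (hσ : 0 ≤ σ) {w : ℂ} (hw : 0 < w.im) :
    0 ≤ (driftField γ σ s w).im := by
  have e : driftField γ σ s w = -((γ : ℂ) + (σ : ℂ) * (1 / (w - (s : ℂ)))) := by
    simp only [driftField]; ring
  rw [e, Complex.neg_im, Complex.add_im, Complex.ofReal_im, Complex.im_ofReal_mul, im_one_div_sub]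
  have : 0 ≤ σ * (w.im * ‖1 / (w - (s : ℂ))‖ ^ 2) := by positivity
  linarith

/-- A first-order expansion of the reciprocal Cauchy transform, with an error that is uniform on
the half-plane `{Im w ≥ c}`. It rests on the identity `w (w G(w) - 1) = ∫ x + ∫ x² / (w - x)`. -/
lemma norm_recipCauchy_sub_le {μ : ProbabilityMeasure ℝ}
    (hμ : ∀ k : ℕ, Integrable (fun x : ℝ => x ^ k) (μ : Measure ℝ)) {c : ℝ} (hc : 0 < c)
    {w : ℂ} (hw : c ≤ w.im) {n m₁ m₂ K : ℝ} (hn : 0 < n) (γ σ s : ℝ)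
    (hm₁ : ∫ x, x ^ 1 ∂(μ : Measure ℝ) = m₁) (hm₂ : ∫ x, x ^ 2 ∂(μ : Measure ℝ) = m₂)
    (hK : n * |m₁| + n * m₂ / c = K) (hKn : 2 * K ≤ n * c) :
    ‖n * (recipCauchy μ w - w) - driftField γ σ s w‖ ≤
      |n * m₁ - γ| + |n * m₂ - σ| / c +
        n * (∫ x : ℝ, x ^ 2 * |x - s| ∂(μ : Measure ℝ)) / c ^ 2 + 2 * K ^ 2 / (n * c) := by
  have hwp : 0 < w.im := hc.trans_le hw
  have hne := sub_ofReal_ne_zero hwp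
  set G := cauchyTransform μ w with hG
  have hG0 : G ≠ 0 := cauchyTransform_ne_zero μ hwp
  have hwc : c ≤ ‖w‖ := hw.trans (Complex.im_le_norm w)
  have hw0 : w ≠ 0 := norm_pos_iff.1 (hc.trans_le hwc)
  have hiC : ∀ k : ℕ, Integrable (fun x : ℝ => (x : ℂ) ^ k) (μ : Measure ℝ) := fun k => by
    have := (hμ k).ofReal (𝕜 := ℂ)
    simpa using this
  have hbd : ∀ k : ℕ, Integrable (fun x : ℝ => (x : ℂ) ^ k * (1 / (w - (x : ℂ))))
      (μ : Measure ℝ) := fun k =>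
    (hiC k).mul_bdd (c := 1 / c) (continuous_one_div_sub hwp).aestronglyMeasurable
      (Eventually.of_forall fun x => norm_one_div_sub_le_of_le hc hw x)
  have hC : ∀ k : ℕ, ∫ x : ℝ, (x : ℂ) ^ k ∂(μ : Measure ℝ)
      = ((∫ x, x ^ k ∂(μ : Measure ℝ) : ℝ) : ℂ) := fun k => by
    rw [← integral_complex_ofReal]
    simp
  set Q : ℂ := ∫ x : ℝ, (x : ℂ) ^ 2 * (1 / (w - (x : ℂ))) ∂(μ : Measure ℝ) with hQ
  have hid : w * (w * G - 1) = m₁ + Q := by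
    have e : ∀ x : ℝ, w ^ 2 * (1 / (w - (x : ℂ)))
        = w + ((x : ℂ) ^ 1 + (x : ℂ) ^ 2 * (1 / (w - (x : ℂ)))) := fun x => by
      have := hne x
      field_simp
      ring
    have h0 : Integrable (fun x : ℝ => (x : ℂ) ^ 1 + (x : ℂ) ^ 2 * (1 / (w - (x : ℂ))))
        (μ : Measure ℝ) := (hiC 1).add (hbd 2)
    have h1 : w ^ 2 * G = w + (m₁ + Q) := by
      rw [hG, cauchyTransform, ← integral_const_mul]
      simp_rw [e]
      rw [integral_add (f := fun _ => w) (integrable_const w) h0,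
        integral_add (hiC 1) (hbd 2), hC, hm₁, ← hQ]
      simp
    linear_combination h1
  have hm₂0 : 0 ≤ m₂ := hm₂ ▸ integral_nonneg fun x => sq_nonneg x
  have hQn : ‖Q‖ ≤ m₂ / c := by
    have h1 : ‖Q‖ ≤ ∫ x : ℝ, x ^ 2 * (1 / c) ∂(μ : Measure ℝ) := by
      refine norm_integral_le_of_norm_le ((hμ 2).mul_const _) (Eventually.of_forall fun x => ?_)
      rw [norm_mul, norm_pow, Complex.norm_real, Real.norm_eq_abs, sq_abs]
      gcongr
      exact norm_one_div_sub_le_of_le hc hw x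
    rw [integral_mul_const, hm₂] at h1
    rwa [div_eq_mul_one_div]
  have hi3 : Integrable (fun x : ℝ => x ^ 2 * |x - s|) (μ : Measure ℝ) := by
    have h1 : Integrable (fun x : ℝ => x ^ 2 * (x - s)) (μ : Measure ℝ) := by
      have h2 := (hμ 3).sub ((hμ 2).const_mul s)
      refine h2.congr (Eventually.of_forall fun x => ?_)
      simp only [Pi.sub_apply]
      ring
    refine h1.norm.congr (Eventually.of_forall fun x => ?_)
    simp
  have hQs : ‖Q - m₂ * (1 / (w - (s : ℂ)))‖
      ≤ (∫ x : ℝ, x ^ 2 * |x - s| ∂(μ : Measure ℝ)) / c ^ 2 := by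
    have e : Q - m₂ * (1 / (w - (s : ℂ))) = ∫ x : ℝ,
        (x : ℂ) ^ 2 * (1 / (w - (x : ℂ))) - (x : ℂ) ^ 2 * (1 / (w - (s : ℂ)))
          ∂(μ : Measure ℝ) := by
      rw [integral_sub (hbd 2) ((hiC 2).mul_const _), integral_mul_const, hC, hm₂]
    rw [e, div_eq_mul_one_div (∫ x : ℝ, x ^ 2 * |x - s| ∂(μ : Measure ℝ)), ← integral_mul_const]
    refine norm_integral_le_of_norm_le (hi3.mul_const _) (Eventually.of_forall fun x => ?_)
    rw [← mul_sub, one_div_sub_sub_one_div_sub (hne x) (hne s), sub_self, zero_add]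
    simp only [norm_mul, norm_pow, Complex.norm_real, Real.norm_eq_abs, sq_abs]
    have h1 : ‖(x : ℂ) - (s : ℂ)‖ = |x - s| := by
      rw [← Complex.ofReal_sub, Complex.norm_real, Real.norm_eq_abs]
    rw [h1]
    calc x ^ 2 * (|x - s| * ‖1 / (w - (x : ℂ))‖ * ‖1 / (w - (s : ℂ))‖)
        ≤ x ^ 2 * (|x - s| * (1 / c) * (1 / c)) := by
          gcongr
          · exact norm_one_div_sub_le_of_le hc hw x
          · exact norm_one_div_sub_le_of_le hc hw s
      _ = x ^ 2 * |x - s| * (1 / c ^ 2) := by field_simp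
  -- `ε` is the relative error in `G(w) ≈ 1 / w`
  set ε : ℂ := w * G - 1 with hε
  have hε1 : 1 + ε ≠ 0 := by
    rw [hε]; simpa using mul_ne_zero hw0 hG0
  have hnwε : ‖(n : ℂ) * (w * ε)‖ ≤ K := by
    rw [hid, norm_mul, Complex.norm_real, Real.norm_eq_abs, abs_of_pos hn, ← hK]
    calc n * ‖(m₁ : ℂ) + Q‖ ≤ n * (|m₁| + m₂ / c) := by
          gcongr
          refine (norm_add_le _ _).trans ?_
          rw [Complex.norm_real, Real.norm_eq_abs]
          gcongr
      _ = n * |m₁| + n * m₂ / c := by ring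
  have hK0 : 0 ≤ K := (norm_nonneg _).trans hnwε
  have hεn : ‖ε‖ ≤ K / (n * c) := by
    rw [le_div_iff₀ (by positivity)]
    rw [norm_mul, norm_mul, Complex.norm_real, Real.norm_eq_abs, abs_of_pos hn] at hnwε
    calc ‖ε‖ * (n * c) = n * (c * ‖ε‖) := by ring
      _ ≤ n * (‖w‖ * ‖ε‖) := by gcongr
      _ ≤ K := hnwε
  have hε2 : ‖ε‖ ≤ 1 / 2 := by
    refine hεn.trans ?_
    rw [div_le_iff₀ (by positivity)]
    linarith
  have hinv : ‖(1 + ε)⁻¹‖ ≤ 2 := by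
    rw [norm_inv, inv_le_comm₀ (norm_pos_iff.2 hε1) two_pos]
    have h1 : ‖(1 : ℂ)‖ - ‖ε‖ ≤ ‖1 + ε‖ := by
      have := norm_sub_norm_le (1 : ℂ) (-ε)
      simpa using this
    rw [norm_one] at h1
    linarith
  have hmain : n * (recipCauchy μ w - w) - driftField γ σ s w =
      -((n * m₁ - γ : ℝ) + (n * m₂ - σ : ℝ) * (1 / (w - (s : ℂ))) +
        n * (Q - m₂ * (1 / (w - (s : ℂ))))) + (n * (w * ε)) * ε * (1 + ε)⁻¹ := by
    have h1 : recipCauchy μ w = w * (1 + ε)⁻¹ := by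
      have h2 : 1 + ε = w * G := by rw [hε]; ring
      rw [h2, recipCauchy, ← hG]
      field_simp
    have h3 : (Q : ℂ) = w * ε - m₁ := by rw [hid]; ring
    have hs : w - (s : ℂ) ≠ 0 := hne s
    rw [h1, h3, driftField]
    push_cast
    field_simp
    ring
  rw [hmain]
  refine (norm_add_le _ _).trans ?_
  rw [norm_neg]
  refine add_le_add ((norm_add₃_le).trans (add_le_add_three ?_ ?_ ?_)) ?_
  · rw [Complex.norm_real, Real.norm_eq_abs]
  · rw [norm_mul, Complex.norm_real, Real.norm_eq_abs, div_eq_mul_one_div |n * m₂ - σ|]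
    gcongr
    exact norm_one_div_sub_le_of_le hc hw s
  · rw [norm_mul, Complex.norm_real, Real.norm_eq_abs, abs_of_pos hn, mul_div_assoc]
    exact mul_le_mul_of_nonneg_left hQs hn.le
  · rw [norm_mul, norm_mul]
    calc ‖(n : ℂ) * (w * ε)‖ * ‖ε‖ * ‖(1 + ε)⁻¹‖ ≤ K * (K / (n * c)) * 2 := by gcongr
      _ = 2 * K ^ 2 / (n * c) := by ring

/-- If `N m₁ → γ`, `N m₂ → σ` and `N ∫ x² (x - s)² → 0`, then `N (H(w) - w)` tends to
`driftField γ σ s`, uniformly on `{Im w ≥ c}` and in the measures with the given moments. -/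
lemma eventually_norm_recipCauchy_sub_le {m : ℕ → ℕ → ℝ} {γ σ s : ℝ}
    (h₁ : Tendsto (fun N : ℕ => (N : ℝ) * m N 1) atTop (𝓝 γ))
    (h₂ : Tendsto (fun N : ℕ => (N : ℝ) * m N 2) atTop (𝓝 σ))
    (h₃ : Tendsto (fun N : ℕ => (N : ℝ) * (m N 4 - 2 * s * m N 3 + s ^ 2 * m N 2)) atTop (𝓝 0))
    (hσ : 0 ≤ σ) {c : ℝ} (hc : 0 < c) {ε : ℝ} (hε : 0 < ε) :
    ∀ᶠ N : ℕ in atTop, ∀ μ : ProbabilityMeasure ℝ,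
      (∀ k : ℕ, Integrable (fun x : ℝ => x ^ k) (μ : Measure ℝ)) →
      (∀ k : ℕ, ∫ x, x ^ k ∂(μ : Measure ℝ) = m N k) → ∀ w : ℂ, c ≤ w.im →
      ‖N * (recipCauchy μ w - w) - driftField γ σ s w‖ ≤ ε := by
  -- the weight in the inequality `2 |x - s| ≤ δ + (x - s)² / δ`
  set δ : ℝ := ε * c ^ 2 / (σ + 1) with hδ
  have hδ0 : 0 < δ := by positivity
  set K : ℕ → ℝ := fun N => N * |m N 1| + N * m N 2 / c with hKdef
  have hK : Tendsto K atTop (𝓝 (|γ| + σ / c)) := by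
    refine Tendsto.add ?_ (h₂.div_const c)
    refine h₁.abs.congr fun N => ?_
    rw [abs_mul, Nat.abs_cast]
  have hnat : Tendsto (fun N : ℕ => (N : ℝ) * c) atTop atTop :=
    tendsto_natCast_atTop_atTop.atTop_mul_const hc
  have hlim : Tendsto (fun N : ℕ => |N * m N 1 - γ| + |N * m N 2 - σ| / c +
      (δ * (N * m N 2) / 2 + N * (m N 4 - 2 * s * m N 3 + s ^ 2 * m N 2) / (2 * δ)) / c ^ 2 +
      2 * K N ^ 2 / (N * c)) atTop
      (𝓝 (|γ - γ| + |σ - σ| / c + (δ * σ / 2 + 0 / (2 * δ)) / c ^ 2 + 0)) := by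
    refine Tendsto.add (Tendsto.add (Tendsto.add ?_ ?_) ?_) ?_
    · exact (h₁.sub_const γ).abs
    · exact (h₂.sub_const σ).abs.div_const c
    · exact (((h₂.const_mul δ).div_const 2).add (h₃.div_const _)).div_const _
    · exact ((hK.pow 2).const_mul 2).div_atTop hnat
  have hval : |γ - γ| + |σ - σ| / c + (δ * σ / 2 + 0 / (2 * δ)) / c ^ 2 + 0 < ε := by
    have : (δ * σ / 2 + 0 / (2 * δ)) / c ^ 2 = ε * (σ / (2 * (σ + 1))) := by
      rw [hδ]; field_simp; ring
    rw [this, sub_self, sub_self, abs_zero, zero_div, zero_add, zero_add, add_zero]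
    have h4 : σ / (2 * (σ + 1)) < 1 := by
      rw [div_lt_one (by positivity)]; linarith
    nlinarith
  filter_upwards [hlim.eventually (gt_mem_nhds hval), eventually_gt_atTop 0,
    hnat.eventually_ge_atTop (2 * (|γ| + σ / c + 1)),
    hK.eventually (gt_mem_nhds (lt_add_one _))] with N hN hN0 hN1 hN2 μ hi hm w hw
  have hNpos : (0 : ℝ) < N := by exact_mod_cast hN0
  have hb := norm_recipCauchy_sub_le hi hc hw hNpos γ σ s (hm 1) (hm 2) (K := K N) rfl
    (by linarith)
  set q : ℝ → ℝ := fun x => x ^ 4 - 2 * s * x ^ 3 + s ^ 2 * x ^ 2 with hq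
  have hq₁ : Integrable (fun x : ℝ => x ^ 4 - 2 * s * x ^ 3) (μ : Measure ℝ) :=
    (hi 4).sub ((hi 3).const_mul _)
  have hq₂ : Integrable q (μ : Measure ℝ) := hq₁.add ((hi 2).const_mul _)
  have e3 : Integrable (fun x : ℝ => δ / 2 * x ^ 2 + 1 / (2 * δ) * q x) (μ : Measure ℝ) :=
    ((hi 2).const_mul _).add (hq₂.const_mul _)
  have hint : ∫ x : ℝ, x ^ 2 * |x - s| ∂(μ : Measure ℝ) ≤
      δ / 2 * m N 2 + 1 / (2 * δ) * (m N 4 - 2 * s * m N 3 + s ^ 2 * m N 2) := by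
    have e : δ / 2 * m N 2 + 1 / (2 * δ) * (m N 4 - 2 * s * m N 3 + s ^ 2 * m N 2) =
        ∫ x : ℝ, (δ / 2 * x ^ 2 + 1 / (2 * δ) * q x) ∂(μ : Measure ℝ) := by
      rw [integral_add ((hi 2).const_mul _) (hq₂.const_mul _), integral_const_mul,
        integral_const_mul, hq, integral_add hq₁ ((hi 2).const_mul _),
        integral_sub (hi 4) ((hi 3).const_mul _), integral_const_mul, integral_const_mul,
        hm, hm, hm]
    rw [e]
    refine integral_mono_of_nonneg (Eventually.of_forall fun x => by positivity) e3
      (Eventually.of_forall fun x => ?_)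
    have h5 : |x - s| ≤ δ / 2 + 1 / (2 * δ) * (x - s) ^ 2 := by
      have h6 : 0 ≤ (δ - |x - s|) ^ 2 / (2 * δ) := by positivity
      have h7 : (δ - |x - s|) ^ 2 / (2 * δ) = δ / 2 + 1 / (2 * δ) * (x - s) ^ 2 - |x - s| := by
        rw [← sq_abs (x - s)]; field_simp; ring
      linarith
    calc x ^ 2 * |x - s| ≤ x ^ 2 * (δ / 2 + 1 / (2 * δ) * (x - s) ^ 2) := by gcongr
      _ = _ := by ring
  have hb' : ((N : ℝ) : ℂ) = (N : ℂ) := Complex.ofReal_natCast N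
  rw [hb'] at hb
  refine hb.trans (le_trans ?_ hN.le)
  gcongr
  calc (N : ℝ) * ∫ x : ℝ, x ^ 2 * |x - s| ∂(μ : Measure ℝ)
      ≤ N * (δ / 2 * m N 2 + 1 / (2 * δ) * (m N 4 - 2 * s * m N 3 + s ^ 2 * m N 2)) := by gcongr
    _ = _ := by ring

end Expansion

/-! ### The flow of a vector field and its approximation by iterated maps -/

section Flow

/-- `y` is a solution on `[0, 1]`, inside the upper half-plane, of the differential equation given
by the vector field `V`. -/
def IsFlowLine (V : ℂ → ℂ) (y : ℝ → ℂ) : Prop :=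
  ∀ t ∈ Set.Icc (0 : ℝ) 1, 0 < (y t).im ∧ HasDerivWithinAt y (V (y t)) (Set.Icc 0 1) t

lemma im_le_im_of_hasDerivWithinAt {y y' : ℝ → ℂ}
    (hy : ∀ t ∈ Set.Icc (0 : ℝ) 1, HasDerivWithinAt y (y' t) (Set.Icc 0 1) t)
    (hy' : ∀ t ∈ Set.Icc (0 : ℝ) 1, 0 ≤ (y' t).im) {t : ℝ} (ht : t ∈ Set.Icc (0 : ℝ) 1) :
    (y 0).im ≤ (y t).im := by
  have hd : ∀ t ∈ Set.Icc (0 : ℝ) 1,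
      HasDerivWithinAt (fun s => (y s).im) (y' t).im (Set.Icc 0 1) t := fun t ht =>
    Complex.imCLM.hasFDerivAt.comp_hasDerivWithinAt t (hy t ht)
  refine monotoneOn_of_hasDerivWithinAt_nonneg (convex_Icc 0 1)
    (fun t ht => (hd t ht).continuousWithinAt)
    (fun t ht => (hd t (interior_subset ht)).mono interior_subset)
    (fun t ht => hy' t (interior_subset ht)) (Set.left_mem_Icc.2 zero_le_one) ht ht.1

/-- Global existence on `[0, 1]` for a field that is bounded and Lipschitz on `{Im w ≥ Im z}` and
points upwards there: the Picard–Lindelöf theorem is applied to the field precomposed with the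
projection to this half-plane, whose integral curves never leave it. -/
lemma exists_isFlowLine {V : ℂ → ℂ} {z : ℂ} (hz : 0 < z.im) {L M : ℝ}
    (hL : ∀ w w' : ℂ, z.im ≤ w.im → z.im ≤ w'.im → ‖V w - V w'‖ ≤ L * ‖w - w'‖)
    (hM : ∀ w : ℂ, z.im ≤ w.im → ‖V w‖ ≤ M)
    (hV : ∀ w : ℂ, z.im ≤ w.im → 0 ≤ (V w).im) :
    ∃ y : ℝ → ℂ, y 0 = z ∧ IsFlowLine V y := by
  set P : ℂ → ℂ := fun w => ⟨w.re, max w.im z.im⟩ with hP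
  have hPim : ∀ w, z.im ≤ (P w).im := fun w => le_max_right _ _
  have hPl : ∀ w w', ‖P w - P w'‖ ≤ ‖w - w'‖ := by
    intro w w'
    refine le_of_sq_le_sq ?_ (norm_nonneg _)
    rw [Complex.sq_norm, Complex.sq_norm, Complex.normSq_apply, Complex.normSq_apply]
    have h1 : ((P w - P w').im) ^ 2 ≤ ((w - w').im) ^ 2 := by
      rw [sq_le_sq]
      exact abs_max_sub_max_le_abs _ _ _
    have h2 : (P w - P w').re = (w - w').re := rfl
    rw [h2]
    nlinarith
  have hM0 : 0 ≤ M := (norm_nonneg _).trans (hM z le_rfl)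
  have hL' : LipschitzWith (Real.toNNReal L) (V ∘ P) := by
    refine LipschitzWith.of_dist_le_mul fun w w' => ?_
    rw [dist_eq_norm, dist_eq_norm]
    calc ‖V (P w) - V (P w')‖ ≤ L * ‖P w - P w'‖ := hL _ _ (hPim w) (hPim w')
      _ ≤ (Real.toNNReal L) * ‖w - w'‖ := by
        gcongr
        · exact Real.le_coe_toNNReal L
        · exact hPl w w'
  have hpl : IsPicardLindelof (fun _ => V ∘ P) (tmin := 0) (tmax := 1)
      ⟨0, Set.left_mem_Icc.2 zero_le_one⟩ z (Real.toNNReal M) 0 (Real.toNNReal M)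
      (Real.toNNReal L) := by
    refine IsPicardLindelof.of_time_independent (fun w _ => ?_) hL'.lipschitzOnWith ?_
    · exact (hM _ (hPim w)).trans (Real.le_coe_toNNReal M)
    · simp
  obtain ⟨y, hy0, hy⟩ := hpl.exists_eq_forall_mem_Icc_hasDerivWithinAt₀
  have hy0' : y 0 = z := hy0
  have him : ∀ t ∈ Set.Icc (0 : ℝ) 1, z.im ≤ (y t).im := fun t ht => by
    rw [← hy0']
    exact im_le_im_of_hasDerivWithinAt hy (fun t _ => hV _ (hPim _)) ht
  refine ⟨y, hy0', fun t ht => ⟨hz.trans_le (him t ht), ?_⟩⟩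
  have h1 : P (y t) = y t := by
    apply Complex.ext
    · rfl
    · exact max_eq_left (him t ht)
  have h2 := hy t ht
  simp only [Function.comp_apply, h1] at h2
  exact h2

/-- One Euler step along a flow line. -/
lemma norm_sub_euler_step_le {V : ℂ → ℂ} {y : ℝ → ℂ} (hy : IsFlowLine V y) {c L M : ℝ}
    (hc : ∀ t ∈ Set.Icc (0 : ℝ) 1, c ≤ (y t).im)
    (hL : ∀ w w' : ℂ, c ≤ w.im → c ≤ w'.im → ‖V w - V w'‖ ≤ L * ‖w - w'‖) (hL0 : 0 ≤ L)
    (hM : ∀ w : ℂ, c ≤ w.im → ‖V w‖ ≤ M) {a b : ℝ} (ha : 0 ≤ a) (hab : a ≤ b) (hb : b ≤ 1) :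
    ‖y b - y a - (b - a) * V (y a)‖ ≤ L * M * (b - a) ^ 2 := by
  have hsub : Set.Icc a b ⊆ Set.Icc (0 : ℝ) 1 := Set.Icc_subset_Icc ha hb
  have haI : a ∈ Set.Icc a b := Set.left_mem_Icc.2 hab
  have hM0 : 0 ≤ M := (norm_nonneg _).trans (hM _ (hc a (hsub haI)))
  have hlip : ∀ s ∈ Set.Icc a b, ‖y s - y a‖ ≤ M * (b - a) := by
    intro s hs
    have h1 := (convex_Icc (0 : ℝ) 1).norm_image_sub_le_of_norm_hasDerivWithin_le
      (fun t ht => (hy t ht).2) (fun t ht => hM _ (hc t ht)) (hsub haI) (hsub hs)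
    rw [Real.norm_eq_abs, abs_of_nonneg (by linarith [hs.1])] at h1
    refine h1.trans ?_
    gcongr
    exact hs.2
  have hd : ∀ s ∈ Set.Icc a b,
      HasDerivWithinAt (fun s : ℝ => y s - (s : ℂ) * V (y a)) (V (y s) - V (y a))
        (Set.Icc a b) s := by
    intro s hs
    have h1 : HasDerivWithinAt (fun s : ℝ => (s : ℂ) * V (y a)) (1 * V (y a)) (Set.Icc a b) s :=
      (Complex.ofRealCLM.hasDerivAt.mul_const _).hasDerivWithinAt
    rw [one_mul] at h1
    exact ((hy s (hsub hs)).2.mono hsub).sub h1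
  have h2 := (convex_Icc a b).norm_image_sub_le_of_norm_hasDerivWithin_le (C := L * M * (b - a))
    hd (fun s hs => ?_) haI (Set.right_mem_Icc.2 hab)
  · rw [Real.norm_eq_abs, abs_of_nonneg (by linarith)] at h2
    calc ‖y b - y a - (b - a) * V (y a)‖
        = ‖y b - (b : ℂ) * V (y a) - (y a - (a : ℂ) * V (y a))‖ := by congr 1; ring
      _ ≤ L * M * (b - a) * (b - a) := h2
      _ = L * M * (b - a) ^ 2 := by ring
  · calc ‖V (y s) - V (y a)‖ ≤ L * ‖y s - y a‖ := hL _ _ (hc s (hsub hs)) (hc a (hsub haI))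
      _ ≤ L * (M * (b - a)) := by gcongr; exact hlip s hs
      _ = L * M * (b - a) := by ring

/-- If each `h k` moves points by `V / N` up to an error `ε / N`, then the composition of
`h 0, …, h (k - 1)` follows the flow of `V` during the time `k / N`. -/
lemma norm_comp_sub_flowLine_le {V : ℂ → ℂ} {y : ℝ → ℂ} (hy : IsFlowLine V y) {c L M : ℝ}
    (hc : ∀ t ∈ Set.Icc (0 : ℝ) 1, c ≤ (y t).im)
    (hL : ∀ w w' : ℂ, c ≤ w.im → c ≤ w'.im → ‖V w - V w'‖ ≤ L * ‖w - w'‖) (hL0 : 0 ≤ L)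
    (hM : ∀ w : ℂ, c ≤ w.im → ‖V w‖ ≤ M) {N : ℕ} (hN : 0 < N) {ε : ℝ}
    {h H : ℕ → ℂ → ℂ} (him : ∀ k < N, ∀ w : ℂ, c ≤ w.im → c ≤ (h k w).im)
    (hh : ∀ k < N, ∀ w : ℂ, c ≤ w.im → ‖N * (h k w - w) - V w‖ ≤ ε)
    (hH0 : ∀ w : ℂ, c ≤ w.im → H 0 w = w)
    (hH : ∀ k < N, ∀ w : ℂ, c ≤ w.im → H (k + 1) w = H k (h k w)) :
    ∀ k ≤ N, ∀ w : ℂ, c ≤ w.im → ‖H k w - y 1‖ ≤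
      (1 + L / N) ^ k * (‖w - y (1 - k / N)‖ + k * ((ε + L * M / N) / N)) := by
  have hNpos : (0 : ℝ) < N := by exact_mod_cast hN
  have hNC : (N : ℂ) ≠ 0 := by exact_mod_cast hN.ne'
  intro k
  induction k with
  | zero => intro _ w hw; simp [hH0 w hw]
  | succ k ih =>
    intro hk w hw
    have hkN : k < N := hk
    have hkr : ((k : ℝ) + 1) / N ≤ 1 := by
      rw [div_le_one hNpos]; exact_mod_cast hk
    set a : ℝ := 1 - (k + 1) / N with ha
    set b : ℝ := 1 - k / N with hb
    have hba : b - a = 1 / N := by rw [ha, hb]; field_simp; ring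
    have ha0 : 0 ≤ a := by rw [ha]; linarith
    have hab : a ≤ b := by
      have : (0 : ℝ) < 1 / N := by positivity
      linarith
    have hb1 : b ≤ 1 := by
      have : (0 : ℝ) ≤ k / N := by positivity
      rw [hb]; linarith
    have hya : c ≤ (y a).im := hc a ⟨ha0, hab.trans hb1⟩
    have h1 := norm_sub_euler_step_le hy hc hL hL0 hM ha0 hab hb1
    have h2 := hh k hkN w hw
    have h3 := hL w (y a) hw hya
    have hbaC : (b : ℂ) - (a : ℂ) = 1 / (N : ℂ) := by
      rw [← Complex.ofReal_sub, hba]; push_cast; rfl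
    rw [hbaC, hba] at h1
    have hstep : ‖h k w - y b‖ ≤ (1 + L / N) * ‖w - y a‖ + (ε + L * M / N) / N := by
      have e : h k w - y b = (w - y a) + (1 / (N : ℂ)) * (V w - V (y a)) +
          ((1 / (N : ℂ)) * (N * (h k w - w) - V w) - (y b - y a - 1 / (N : ℂ) * V (y a))) := by
        field_simp
        ring
      have hn : ‖(1 / (N : ℂ))‖ = 1 / N := by simp
      rw [e]
      calc _ ≤ ‖w - y a‖ + ‖(1 / (N : ℂ)) * (V w - V (y a))‖ +
            (‖(1 / (N : ℂ)) * (N * (h k w - w) - V w)‖ + ‖y b - y a - 1 / (N : ℂ) * V (y a)‖) :=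
              (norm_add_le _ _).trans (add_le_add (norm_add_le _ _) (norm_sub_le _ _))
        _ ≤ ‖w - y a‖ + 1 / N * (L * ‖w - y a‖) + (1 / N * ε + L * M * (1 / N) ^ 2) := by
              rw [norm_mul, norm_mul, hn]
              gcongr
        _ = _ := by field_simp
    rw [hH k hkN w hw]
    refine (ih hkN.le (h k w) (him k hkN w hw)).trans ?_
    have ek : ((k + 1 : ℕ) : ℝ) = (k : ℝ) + 1 := by push_cast; ring
    rw [ek, ← ha, pow_succ, mul_assoc]
    have hLN : 0 ≤ L / N := by positivity
    have hη : 0 ≤ (ε + L * M / N) / N := by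
      have h5 : 0 ≤ ε := (norm_nonneg _).trans h2
      have h6 : 0 ≤ M := (norm_nonneg _).trans (hM _ hw)
      positivity
    have hLN' : 1 ≤ 1 + L / N := by linarith
    gcongr
    generalize (ε + L * M / N) / N = η at hstep hη ⊢
    generalize ‖w - y a‖ = d at hstep ⊢
    have h7 : (k + 1) * η ≤ (1 + L / N) * ((k + 1) * η) :=
      le_mul_of_one_le_left (by positivity) hLN'
    linarith

lemma norm_comp_sub_flowLine_le_exp {V : ℂ → ℂ} {y : ℝ → ℂ} (hy : IsFlowLine V y) {c L M : ℝ}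
    (hc : ∀ t ∈ Set.Icc (0 : ℝ) 1, c ≤ (y t).im)
    (hL : ∀ w w' : ℂ, c ≤ w.im → c ≤ w'.im → ‖V w - V w'‖ ≤ L * ‖w - w'‖) (hL0 : 0 ≤ L)
    (hM : ∀ w : ℂ, c ≤ w.im → ‖V w‖ ≤ M) {N : ℕ} (hN : 0 < N) {ε : ℝ}
    {h H : ℕ → ℂ → ℂ} (him : ∀ k < N, ∀ w : ℂ, c ≤ w.im → c ≤ (h k w).im)
    (hh : ∀ k < N, ∀ w : ℂ, c ≤ w.im → ‖N * (h k w - w) - V w‖ ≤ ε)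
    (hH0 : ∀ w : ℂ, c ≤ w.im → H 0 w = w)
    (hH : ∀ k < N, ∀ w : ℂ, c ≤ w.im → H (k + 1) w = H k (h k w)) :
    ‖H N (y 0) - y 1‖ ≤ Real.exp L * (ε + L * M / N) := by
  have hNpos : (0 : ℝ) < N := by exact_mod_cast hN
  have h0 : c ≤ (y 0).im := hc 0 (Set.left_mem_Icc.2 zero_le_one)
  have h1 := norm_comp_sub_flowLine_le hy hc hL hL0 hM hN him hh hH0 hH N le_rfl (y 0) h0
  rw [div_self hNpos.ne', sub_self, sub_self, norm_zero, zero_add, mul_div_cancel₀ _ hNpos.ne']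
    at h1
  refine h1.trans (mul_le_mul_of_nonneg_right ?_ ?_)
  · calc (1 + L / N) ^ N ≤ Real.exp (L / N) ^ N := by
          gcongr
          linarith [Real.add_one_le_exp (L / N)]
      _ = Real.exp L := by
          rw [← Real.exp_nat_mul, mul_div_cancel₀ _ hNpos.ne']
  · have h5 : 0 ≤ ε := (norm_nonneg _).trans (hh 0 hN _ h0)
    have h6 : 0 ≤ M := (norm_nonneg _).trans (hM _ h0)
    positivity

/-- The recursion of the c-monotone convolution adds up the displacements `f k w - w` along the
orbit of `w` under the maps `h k`; if these are `t` times the displacements `h k w - w` up to `δ`,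
so is the total displacement. -/
lemma norm_sub_sub_mul_le {c δ : ℝ} {t : ℂ} {N : ℕ} {f h F H : ℕ → ℂ → ℂ}
    (him : ∀ k < N, ∀ w : ℂ, c ≤ w.im → c ≤ (h k w).im)
    (hδ : ∀ k < N, ∀ w : ℂ, c ≤ w.im → ‖f k w - w - t * (h k w - w)‖ ≤ δ)
    (hF0 : ∀ w : ℂ, c ≤ w.im → F 0 w = w) (hH0 : ∀ w : ℂ, c ≤ w.im → H 0 w = w)
    (hF : ∀ k < N, ∀ w : ℂ, c ≤ w.im → F (k + 1) w = F k (h k w) + (f k w - h k w))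
    (hH : ∀ k < N, ∀ w : ℂ, c ≤ w.im → H (k + 1) w = H k (h k w)) :
    ∀ k ≤ N, ∀ w : ℂ, c ≤ w.im → ‖F k w - w - t * (H k w - w)‖ ≤ k * δ := by
  intro k
  induction k with
  | zero => intro _ w hw; simp [hF0 w hw, hH0 w hw]
  | succ k ih =>
    intro hk w hw
    have e : F (k + 1) w - w - t * (H (k + 1) w - w) =
        (F k (h k w) - h k w - t * (H k (h k w) - h k w)) + (f k w - w - t * (h k w - w)) := by
      rw [hF k hk w hw, hH k hk w hw]; ring
    rw [e]
    refine (norm_add_le _ _).trans ?_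
    have h1 := ih (Nat.le_of_succ_le hk) _ (him k hk w hw)
    have h2 := hδ k hk w hw
    push_cast
    linarith

end Flow

/-! ### A limit theorem for infinitesimal arrays -/

section FlowLines

lemma IsFlowLine.im_le_im {V : ℂ → ℂ} {y : ℝ → ℂ} (hy : IsFlowLine V y)
    (hV : ∀ w : ℂ, 0 < w.im → 0 ≤ (V w).im) {t : ℝ} (ht : t ∈ Set.Icc (0 : ℝ) 1) :
    (y 0).im ≤ (y t).im :=
  im_le_im_of_hasDerivWithinAt (fun t ht => (hy t ht).2) (fun t ht => hV _ (hy t ht).1) ht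

lemma exists_isFlowLine_driftField (γ : ℝ) {σ : ℝ} (s : ℝ) (hσ : 0 ≤ σ) {z : ℂ}
    (hz : 0 < z.im) : ∃ y : ℝ → ℂ, y 0 = z ∧ IsFlowLine (driftField γ σ s) y :=
  exists_isFlowLine hz (fun _ _ hw hw' => norm_driftField_sub_le γ s hσ hz hw hw')
    (fun _ hw => norm_driftField_le γ s hσ hz hw)
    fun _ hw => im_driftField_nonneg γ s hσ (hz.trans_le hw)

end FlowLines

section Array

variable {A : Type*} [CStarAlgebra A]

lemma coe_sum_selfAdjoint (X : ℕ → selfAdjoint A) (s : Finset ℕ) :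
    ((∑ n ∈ s, X n : selfAdjoint A) : A) = ∑ n ∈ s, (X n : A) :=
  map_sum (selfAdjoint A).subtype X s

/-- The subalgebra generated without the unit by the `n`-th variable. -/
noncomputable def generated (X : ℕ → selfAdjoint A) (N : ℕ) (n : Fin N) : NonUnitalSubalgebra ℂ A :=
  NonUnitalAlgebra.adjoin ℂ {(X n : A)}

lemma mem_generated (X : ℕ → selfAdjoint A) {N n : ℕ} (hn : n < N) :
    (X n : A) ∈ generated X N ⟨n, hn⟩ :=
  NonUnitalAlgebra.self_mem_adjoin_singleton ℂ _

variable [PartialOrder A] [StarOrderedRing A] {φ ψ : A →ₚ[ℂ] ℂ}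

lemma recipCauchy_law_zero (hφ : φ 1 = 1) {z : ℂ} (hz : 0 < z.im) :
    recipCauchy (law φ hφ 0) z = z := by
  have hz0 : z ≠ 0 := fun h => by simp [h] at hz
  have h1 : resolvent ((0 : selfAdjoint A) : A) z = z⁻¹ • (1 : A) := by
    have h2 := resolvent_mul_sub (0 : selfAdjoint A) hz
    rw [ZeroMemClass.coe_zero, sub_zero, ← Algebra.commutes, ← Algebra.smul_def] at h2
    rw [← h2, smul_smul, inv_mul_cancel₀ hz0, one_smul, ZeroMemClass.coe_zero]
  rw [recipCauchy, cauchyTransform_law _ _ _ hz, h1, map_smul, hφ]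
  simp

/-- The mixed second moments of distinct variables factorise, so that the second moment of a sum is
bounded by the first two moments of its terms. -/
lemma integral_sq_law_sum_le {N : ℕ} {X : ℕ → selfAdjoint A} (hφ : φ 1 = 1)
    (h : IsCMonotoneIndependent φ ψ (generated X N))
    (hid : IdenticallyDistributed φ fun n : Fin N => X n) :
    ∫ x, x ^ 2 ∂(law φ hφ (∑ n ∈ Finset.range N, X n) : Measure ℝ) ≤
      N * (φ ((X 0 : A) ^ 2)).re + (N * (φ ((X 0 : A) ^ 1)).re) ^ 2 := by
  have hmom : ∀ n < N, ∀ k : ℕ, φ ((X n : A) ^ k) = φ ((X 0 : A) ^ k) := fun n hn k =>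
    hid ⟨n, hn⟩ ⟨0, Nat.zero_lt_of_lt hn⟩ k
  set m₁ := (φ ((X 0 : A) ^ 1)).re with hm₁
  set m₂ := (φ ((X 0 : A) ^ 2)).re with hm₂
  have hm₁' : φ (X 0 : A) = m₁ := by
    rw [hm₁, pow_one, ofReal_re_apply_of_isSelfAdjoint φ (X 0).2]
  rw [integral_pow_law, coe_sum_selfAdjoint, sq, Finset.sum_mul_sum, map_sum]
  have hterm : ∀ i ∈ Finset.range N, ∀ j ∈ Finset.range N,
      (φ ((X i : A) * X j)).re ≤ (if i = j then m₂ else 0) + m₁ ^ 2 := by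
    intro i hi j hj
    rw [Finset.mem_range] at hi hj
    split_ifs with hij
    · rw [← hij, ← sq, hmom i hi 2]
      nlinarith [sq_nonneg m₁]
    · have h1 := h.apply_mul (i := ⟨i, hi⟩) (j := ⟨j, hj⟩) (by simpa using hij)
        (mem_generated X hi) (mem_generated X hj)
      have h2 := hmom i hi 1
      have h3 := hmom j hj 1
      rw [pow_one, pow_one] at h2 h3
      rw [h1, h2, h3, hm₁', ← Complex.ofReal_mul, Complex.ofReal_re, zero_add, sq]
  calc (∑ i ∈ Finset.range N, φ (∑ j ∈ Finset.range N, (X i : A) * X j)).re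
      = ∑ i ∈ Finset.range N, ∑ j ∈ Finset.range N, (φ ((X i : A) * X j)).re := by
        simp_rw [map_sum, Complex.re_sum]
    _ ≤ ∑ i ∈ Finset.range N, ∑ j ∈ Finset.range N, ((if i = j then m₂ else 0) + m₁ ^ 2) :=
        Finset.sum_le_sum fun i hi => Finset.sum_le_sum fun j hj => hterm i hi j hj
    _ = ∑ i ∈ Finset.range N, (m₂ + N * m₁ ^ 2) := by
        refine Finset.sum_congr rfl fun i hi => ?_
        rw [Finset.sum_add_distrib, Finset.sum_ite_eq, if_pos hi]
        simp
    _ = N * m₂ + (N * m₁) ^ 2 := by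
        simp
        ring

/-- The recursion for the reciprocal Cauchy transforms of the partial sums of a c-monotone
independent family. -/
lemma recipCauchy_law_sum_succ {N : ℕ} {X : ℕ → selfAdjoint A} (hφ : φ 1 = 1) (hψ : ψ 1 = 1)
    (h : IsCMonotoneIndependent φ ψ (generated X N)) {k : ℕ} (hk : k < N) {w : ℂ}
    (hw : 0 < w.im) :
    recipCauchy (law φ hφ (∑ n ∈ Finset.range (k + 1), X n)) w =
      recipCauchy (law φ hφ (∑ n ∈ Finset.range k, X n)) (recipCauchy (law ψ hψ (X k)) w) +
        (recipCauchy (law φ hφ (X k)) w - recipCauchy (law ψ hψ (X k)) w) := by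
  rw [Finset.sum_range_succ]
  refine h.recipCauchy_law_add hφ hψ (k := ⟨k, hk⟩) ?_ (mem_generated X hk) hw
  rw [coe_sum_selfAdjoint]
  refine Submodule.sum_mem _ fun n hn => Submodule.subset_span ?_
  have hnk : n < k := Finset.mem_range.1 hn
  exact ⟨⟨n, hnk.trans hk⟩, hnk, mem_generated X _⟩

/-- The rows of the array consist of identically distributed variables, and for the common law `μ_N`
of the variables in row `N`, `N ∫ x dμ_N → γ`, `N ∫ x² dμ_N → σ` and `N ∫ x² (x - s)² dμ_N → 0`.
So the measures `N x² dμ_N` tend to `σ δ_s`. -/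
structure IsInfinitesimal (φ : A →ₚ[ℂ] ℂ) (X : ℕ → ℕ → selfAdjoint A) (γ σ s : ℝ) : Prop where
  identicallyDistributed : ∀ N : ℕ, IdenticallyDistributed φ fun n : Fin N => X N n
  first : Tendsto (fun N : ℕ => (N : ℝ) * (φ ((X N 0 : A) ^ 1)).re) atTop (𝓝 γ)
  second : Tendsto (fun N : ℕ => (N : ℝ) * (φ ((X N 0 : A) ^ 2)).re) atTop (𝓝 σ)
  fourth : Tendsto (fun N : ℕ => (N : ℝ) * ((φ ((X N 0 : A) ^ 4)).re -
    2 * s * (φ ((X N 0 : A) ^ 3)).re + s ^ 2 * (φ ((X N 0 : A) ^ 2)).re)) atTop (𝓝 0)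

lemma IsInfinitesimal.eventually_norm_le {X : ℕ → ℕ → selfAdjoint A} {γ σ s : ℝ}
    (h : IsInfinitesimal φ X γ σ s) (hφ : φ 1 = 1) (hσ : 0 ≤ σ) {c : ℝ} (hc : 0 < c) {ε : ℝ}
    (hε : 0 < ε) : ∀ᶠ N : ℕ in atTop, ∀ k < N, ∀ w : ℂ, c ≤ w.im →
      ‖N * (recipCauchy (law φ hφ (X N k)) w - w) - driftField γ σ s w‖ ≤ ε := by
  filter_upwards [eventually_norm_recipCauchy_sub_le
    (m := fun N k => (φ ((X N 0 : A) ^ k)).re) h.first h.second h.fourth hσ hc hε]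
    with N hN k hk w hw
  refine hN _ (fun j => integrable_law φ hφ _ (by fun_prop)) (fun j => ?_) w hw
  rw [integral_pow_law]
  exact congrArg Complex.re
    (h.identicallyDistributed N ⟨k, hk⟩ ⟨0, Nat.zero_lt_of_lt hk⟩ j)

lemma IsInfinitesimal.exists_integral_sq_le {X : ℕ → ℕ → selfAdjoint A} {γ σ s : ℝ}
    (h : IsInfinitesimal φ X γ σ s) (hφ : φ 1 = 1)
    (hind : ∀ N, IsCMonotoneIndependent φ ψ (generated (X N) N)) :
    ∃ C : ℝ, ∀ N : ℕ,
      ∫ x, x ^ 2 ∂(law φ hφ (∑ n ∈ Finset.range N, X N n) : Measure ℝ) ≤ C := by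
  obtain ⟨C, hC⟩ := (h.second.add (h.first.pow 2)).bddAbove_range
  exact ⟨C, fun N => (integral_sq_law_sum_le hφ (hind N) (h.identicallyDistributed N)).trans
    (hC ⟨N, rfl⟩)⟩

/-- With respect to `ψ`, the reciprocal Cauchy transform of a row sum is the composition of those of
its terms, each of which is nearly an Euler step of length `1 / N` for the drift field. -/
lemma tendsto_recipCauchy_law_sum {X : ℕ → ℕ → selfAdjoint A} {γ σ s : ℝ} (hψ : ψ 1 = 1)
    (h : IsInfinitesimal ψ X γ σ s) (hσ : 0 ≤ σ)
    (hind : ∀ N, IsCMonotoneIndependent ψ ψ (generated (X N) N)) {y : ℝ → ℂ}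
    (hy : IsFlowLine (driftField γ σ s) y) :
    Tendsto (fun N : ℕ => recipCauchy (law ψ hψ (∑ n ∈ Finset.range N, X N n)) (y 0)) atTop
      (𝓝 (y 1)) := by
  set c := (y 0).im with hcdef
  have hc : 0 < c := (hy 0 (Set.left_mem_Icc.2 zero_le_one)).1
  have hyc : ∀ t ∈ Set.Icc (0 : ℝ) 1, c ≤ (y t).im := fun t ht =>
    hy.im_le_im (fun w hw => im_driftField_nonneg γ s hσ hw) ht
  set L := σ / c ^ 2 with hL
  have hL0 : 0 ≤ L := by positivity
  set M := |γ| + σ / c with hM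
  rw [Metric.tendsto_nhds]
  intro e he
  set ε := e / (2 * Real.exp L) with hε
  have hε0 : 0 < ε := by positivity
  have hlim : Tendsto (fun N : ℕ => Real.exp L * (ε + L * M / N)) atTop
      (𝓝 (Real.exp L * (ε + 0))) :=
    ((tendsto_const_div_atTop_nhds_zero_nat (L * M)).const_add ε).const_mul _
  have hval : Real.exp L * (ε + 0) < e := by
    have : Real.exp L * (ε + 0) = e / 2 := by rw [hε]; field_simp; ring
    linarith
  filter_upwards [h.eventually_norm_le hψ hσ hc hε0, hlim.eventually (gt_mem_nhds hval),
    eventually_gt_atTop 0] with N hN hlt hN0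
  rw [dist_eq_norm]
  refine lt_of_le_of_lt ?_ hlt
  refine norm_comp_sub_flowLine_le_exp
    (H := fun k => recipCauchy (law ψ hψ (∑ n ∈ Finset.range k, X N n)))
    hy hyc (fun w w' hw hw' => norm_driftField_sub_le γ s hσ hc hw hw') hL0
    (fun w hw => norm_driftField_le γ s hσ hc hw) hN0
    (fun k _ w hw => hw.trans (im_le_im_recipCauchy _ (hc.trans_le hw))) hN ?_ ?_
  · intro w hw
    rw [Finset.sum_range_zero, recipCauchy_law_zero hψ (hc.trans_le hw)]
  · intro k hk w hw
    rw [recipCauchy_law_sum_succ hψ hψ (hind N) hk (hc.trans_le hw), sub_self, add_zero]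

/-- The displacement `H(z) - z` of a row sum with respect to `φ` is asymptotically `t` times that
with respect to `ψ`, because this holds for each term. -/
lemma tendsto_recipCauchy_law_sum_sub {X : ℕ → ℕ → selfAdjoint A} {t γ σ s : ℝ} (hφ : φ 1 = 1)
    (hψ : ψ 1 = 1) (hXφ : IsInfinitesimal φ X (t * γ) (t * σ) s)
    (hXψ : IsInfinitesimal ψ X γ σ s) (ht : 0 ≤ t) (hσ : 0 ≤ σ)
    (hind : ∀ N, IsCMonotoneIndependent φ ψ (generated (X N) N)) {z : ℂ} (hz : 0 < z.im) :
    Tendsto (fun N : ℕ => recipCauchy (law φ hφ (∑ n ∈ Finset.range N, X N n)) z - z -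
      t * (recipCauchy (law ψ hψ (∑ n ∈ Finset.range N, X N n)) z - z)) atTop (𝓝 0) := by
  rw [Metric.tendsto_nhds]
  intro e he
  set ε := e / (2 * (1 + t)) with hε
  have hε0 : 0 < ε := by positivity
  filter_upwards [hXφ.eventually_norm_le hφ (by positivity) hz hε0,
    hXψ.eventually_norm_le hψ hσ hz hε0, eventually_gt_atTop 0] with N hN₁ hN₂ hN0
  have hNpos : (0 : ℝ) < N := by exact_mod_cast hN0
  have hNC : (N : ℂ) ≠ 0 := by exact_mod_cast hN0.ne'
  rw [dist_zero_right]
  have key := norm_sub_sub_mul_le (c := z.im) (δ := (1 + t) * ε / N) (t := t) (N := N)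
    (f := fun k => recipCauchy (law φ hφ (X N k))) (h := fun k => recipCauchy (law ψ hψ (X N k)))
    (F := fun k => recipCauchy (law φ hφ (∑ n ∈ Finset.range k, X N n)))
    (H := fun k => recipCauchy (law ψ hψ (∑ n ∈ Finset.range k, X N n)))
    (fun k _ w hw => hw.trans (im_le_im_recipCauchy _ (hz.trans_le hw))) ?_ ?_ ?_ ?_ ?_
    N le_rfl z le_rfl
  · refine key.trans_lt ?_
    have : (N : ℝ) * ((1 + t) * ε / N) = e / 2 := by rw [hε]; field_simp
    linarith
  · intro k hk w hw
    set f := recipCauchy (law φ hφ (X N k)) w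
    set h := recipCauchy (law ψ hψ (X N k)) w
    have e1 : f - w - t * (h - w) = (1 / (N : ℂ)) * ((N * (f - w) - driftField (t * γ) (t * σ) s w)
        - t * (N * (h - w) - driftField γ σ s w)) := by
      rw [driftField_mul]
      field_simp
      ring
    have hn : ‖(1 / (N : ℂ))‖ = 1 / N := by simp
    rw [e1, norm_mul, hn]
    calc _ ≤ 1 / (N : ℝ) * (ε + t * ε) := by
          gcongr
          refine (norm_sub_le _ _).trans (add_le_add (hN₁ k hk w hw) ?_)
          rw [norm_mul, Complex.norm_real, Real.norm_eq_abs, abs_of_nonneg ht]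
          gcongr
          exact hN₂ k hk w hw
      _ = _ := by ring
  · intro w hw
    rw [Finset.sum_range_zero, recipCauchy_law_zero hφ (hz.trans_le hw)]
  · intro w hw
    rw [Finset.sum_range_zero, recipCauchy_law_zero hψ (hz.trans_le hw)]
  · intro k hk w hw
    exact recipCauchy_law_sum_succ hφ hψ (hind N) hk (hz.trans_le hw)
  · intro k hk w hw
    rw [recipCauchy_law_sum_succ hψ hψ (hind N).monotone.isCMonotoneIndependent hk
      (hz.trans_le hw), sub_self, add_zero]

/-- The limit theorem for infinitesimal arrays of c-monotone independent variables: with respect to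
`ψ` the row sums converge to the law whose reciprocal Cauchy transform is the time-one map of the
flow of the drift field, and with respect to `φ` to its `t`-transform. -/
theorem exists_tendsto_law_sum {X : ℕ → ℕ → selfAdjoint A} {t γ σ s : ℝ} (hφ : φ 1 = 1)
    (hψ : ψ 1 = 1) (hXφ : IsInfinitesimal φ X (t * γ) (t * σ) s)
    (hXψ : IsInfinitesimal ψ X γ σ s) (ht : 0 ≤ t) (hσ : 0 ≤ σ)
    (hind : ∀ N, IsCMonotoneIndependent φ ψ (generated (X N) N)) :
    ∃ p κ : ProbabilityMeasure ℝ,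
      (∀ y : ℝ → ℂ, IsFlowLine (driftField γ σ s) y → recipCauchy p (y 0) = y 1) ∧
      IsTTransform t p κ ∧
      Tendsto (fun N : ℕ => (law φ hφ (∑ n ∈ Finset.range N, X N n),
        law ψ hψ (∑ n ∈ Finset.range N, X N n))) atTop (𝓝 (κ, p)) := by
  have hindψ : ∀ N, IsCMonotoneIndependent ψ ψ (generated (X N) N) := fun N =>
    (hind N).monotone.isCMonotoneIndependent
  have hG : ∀ (μ : ProbabilityMeasure ℝ) (z : ℂ), cauchyTransform μ z = (recipCauchy μ z)⁻¹ :=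
    fun μ z => by rw [recipCauchy, one_div, inv_inv]
  choose! Y hY0 hY using fun (z : ℂ) (hz : 0 < z.im) => exists_isFlowLine_driftField γ s hσ hz
  have him : ∀ z : ℂ, 0 < z.im → 0 < (Y z 1).im := fun z hz =>
    (hY z hz 1 (Set.right_mem_Icc.2 zero_le_one)).1
  have hlimψ : ∀ z : ℂ, 0 < z.im →
      Tendsto (fun N : ℕ => recipCauchy (law ψ hψ (∑ n ∈ Finset.range N, X N n)) z) atTop
        (𝓝 (Y z 1)) := fun z hz => by
    have := tendsto_recipCauchy_law_sum hψ hXψ hσ hindψ (hY z hz)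
    rwa [hY0 z hz] at this
  have hlimφ : ∀ z : ℂ, 0 < z.im →
      Tendsto (fun N : ℕ => recipCauchy (law φ hφ (∑ n ∈ Finset.range N, X N n)) z) atTop
        (𝓝 ((1 - t) * z + t * Y z 1)) := fun z hz => by
    have h1 := (tendsto_recipCauchy_law_sum_sub hφ hψ hXφ hXψ ht hσ hind hz).add
      (((hlimψ z hz).sub_const z).const_mul (t : ℂ) |>.add_const z)
    convert h1 using 2 <;> ring
  have hne : ∀ z : ℂ, 0 < z.im → (1 - t) * z + t * Y z 1 ≠ 0 := by
    intro z hz h0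
    have hge : z.im ≤ ((1 - t) * z + t * Y z 1).im := ge_of_tendsto'
      ((Complex.continuous_im.tendsto _).comp (hlimφ z hz)) fun N => im_le_im_recipCauchy _ hz
    rw [h0, Complex.zero_im] at hge
    linarith
  obtain ⟨C₁, hC₁⟩ := hXψ.exists_integral_sq_le hψ hindψ
  obtain ⟨C₂, hC₂⟩ := hXφ.exists_integral_sq_le hφ hind
  obtain ⟨p, hp, hpt⟩ := exists_tendsto_of_tendsto_cauchyTransform
    (fun N => integrable_law ψ hψ _ (by fun_prop)) hC₁ (g := fun z => (Y z 1)⁻¹)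
    fun z hz => by
      simp_rw [hG]
      exact (hlimψ z hz).inv₀ fun h => by simpa [h] using him z hz
  obtain ⟨κ, hκ, hκt⟩ := exists_tendsto_of_tendsto_cauchyTransform
    (fun N => integrable_law φ hφ _ (by fun_prop)) hC₂
    (g := fun z => ((1 - t) * z + t * Y z 1)⁻¹)
    fun z hz => by
      simp_rw [hG]
      exact (hlimφ z hz).inv₀ (hne z hz)
  have hpY : ∀ z : ℂ, 0 < z.im → recipCauchy p z = Y z 1 := fun z hz => by
    rw [recipCauchy, hp z hz, one_div, inv_inv]
  refine ⟨p, κ, fun y hy => ?_, fun z hz => ?_, hκt.prodMk_nhds hpt⟩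
  · have hz : 0 < (y 0).im := (hy 0 (Set.left_mem_Icc.2 zero_le_one)).1
    rw [hpY _ hz]
    exact tendsto_nhds_unique (hlimψ _ hz) (tendsto_recipCauchy_law_sum hψ hXψ hσ hindψ hy)
  · rw [hpY z hz, recipCauchy, hκ z hz, one_div, inv_inv]

end Array

/-! ### Cauchy transforms of the arcsine laws and the Kesten distributions -/

section IntervalDensity

/-- The measure with density `d` on the interval `(-r, r)`; negative values of `d` count as zero. -/
noncomputable def intervalDensity (r : ℝ) (d : ℝ → ℝ) : Measure ℝ :=
  (volume.restrict (Set.Ioo (-r) r)).withDensity fun x => ENNReal.ofReal (d x)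

variable {r : ℝ} {d : ℝ → ℝ}

lemma ae_intervalDensity_mem : ∀ᵐ x ∂(intervalDensity r d), x ∈ Set.Ioo (-r) r :=
  (withDensity_absolutelyContinuous _ _).ae_le (ae_restrict_mem measurableSet_Ioo)

lemma integral_intervalDensity (hr : 0 ≤ r) (hd : Measurable d)
    (hd0 : ∀ x ∈ Set.Ioo (-r) r, 0 ≤ d x) (f : ℝ → ℂ) :
    ∫ x, f x ∂(intervalDensity r d) = ∫ x in (-r)..r, (d x : ℂ) * f x := by
  rw [intervalDensity, integral_withDensity_eq_integral_toReal_smul hd.ennreal_ofReal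
    (Eventually.of_forall fun x => ENNReal.ofReal_lt_top),
    intervalIntegral.integral_of_le (by linarith), integral_Ioc_eq_integral_Ioo]
  refine setIntegral_congr_fun measurableSet_Ioo fun x hx => ?_
  simp only [ENNReal.toReal_ofReal (hd0 x hx)]
  rw [Complex.real_smul]

lemma intervalIntegrable_of_integrable_intervalDensity (hr : 0 ≤ r) (hd : Measurable d)
    (hd0 : ∀ x ∈ Set.Ioo (-r) r, 0 ≤ d x) {f : ℝ → ℂ} (hf : Integrable f (intervalDensity r d)) :
    IntervalIntegrable (fun x => (d x : ℂ) * f x) volume (-r) r := by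
  rw [intervalDensity, integrable_withDensity_iff_integrable_smul' hd.ennreal_ofReal
    (Eventually.of_forall fun x => ENNReal.ofReal_lt_top)] at hf
  rw [intervalIntegrable_iff_integrableOn_Ioo_of_le (by linarith)]
  refine (integrableOn_congr_fun (fun x hx => ?_) measurableSet_Ioo).1 hf
  simp only [ENNReal.toReal_ofReal (hd0 x hx)]
  rw [Complex.real_smul]

lemma integrable_intervalDensity_of_continuous [IsFiniteMeasure (intervalDensity r d)] {f : ℝ → ℂ}
    (hf : Continuous f) : Integrable f (intervalDensity r d) := by
  obtain ⟨C, hC⟩ := isCompact_Icc.exists_bound_of_continuousOn (s := Set.Icc (-r) r)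
    hf.continuousOn
  refine Integrable.mono' (integrable_const C) hf.aestronglyMeasurable ?_
  filter_upwards [ae_intervalDensity_mem] with x hx using hC x (Set.Ioo_subset_Icc_self hx)

lemma integral_id_intervalDensity (hr : 0 ≤ r) (hd : Measurable d)
    (hd0 : ∀ x ∈ Set.Ioo (-r) r, 0 ≤ d x) (heven : ∀ x, d (-x) = d x) :
    ∫ x : ℝ, (x : ℂ) ∂(intervalDensity r d) = 0 := by
  rw [integral_intervalDensity hr hd hd0]
  have h := intervalIntegral.integral_comp_neg (a := -r) (b := r)
    (fun x : ℝ => (d x : ℂ) * (x : ℂ))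
  simp only [heven, Complex.ofReal_neg, mul_neg, neg_neg, intervalIntegral.integral_neg] at h
  exact self_eq_neg.1 h.symm

/-- The mass of a measure on an interval, by the fundamental theorem of calculus. -/
lemma intervalDensity_univ (hr : 0 ≤ r) {Φ : ℝ → ℝ} (hΦ : ContinuousOn Φ (Set.Icc (-r) r))
    (hderiv : ∀ x ∈ Set.Ioo (-r) r, HasDerivAt Φ (d x) x)
    (hd0 : ∀ x ∈ Set.Ioo (-r) r, 0 ≤ d x) :
    intervalDensity r d Set.univ = ENNReal.ofReal (Φ r - Φ (-r)) := by
  have hle : -r ≤ r := by linarith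
  have hint := intervalIntegral.integrableOn_deriv_of_nonneg hΦ hderiv hd0
  have hval := intervalIntegral.integral_eq_sub_of_hasDerivAt_of_le hle hΦ hderiv
    ((intervalIntegrable_iff_integrableOn_Ioc_of_le hle).2 hint)
  rw [intervalDensity, withDensity_apply _ MeasurableSet.univ, Measure.restrict_univ,
    ← ofReal_integral_eq_lintegral_ofReal (hint.mono_set Set.Ioo_subset_Ioc_self)
      ((ae_restrict_iff' measurableSet_Ioo).2 (Eventually.of_forall hd0)),
    ← integral_Ioc_eq_integral_Ioo, ← intervalIntegral.integral_of_le hle, hval]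

end IntervalDensity

section Arcsine

lemma sub_sq_pos_of_mem_Ioo {v x : ℝ} (hx : x ∈ Set.Ioo (-√(2 * v)) √(2 * v)) :
    0 < 2 * v - x ^ 2 := by
  have h1 : |x| < √(2 * v) := abs_lt.2 hx
  have h2 : |x| ^ 2 < 2 * v := by
    have := Real.lt_sqrt (abs_nonneg x) |>.1 h1
    exact this
  rw [sq_abs] at h2
  linarith

lemma measurable_arcsineDensity (v : ℝ) :
    Measurable fun x : ℝ => 1 / (Real.pi * √(2 * v - x ^ 2)) := by fun_prop

/-- The integral of the derivative of `√(2v - x²) / (z - x)`, which vanishes at the endpoints of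
`[-√(2v), √(2v)]`. With `G' = -∫ (z - x)⁻²` this is a differential equation for the Cauchy
transform `G` of the arcsine law. -/
lemma arcsineLaw_ode {v : ℝ} (hv : 0 < v) {z : ℂ} (hz : 0 < z.im) :
    z * cauchyTransform (arcsineLaw v hv) z +
      (2 * v - z ^ 2) * ∫ x : ℝ, (1 / (z - (x : ℂ))) ^ 2 ∂(arcsineLaw v hv : Measure ℝ) = 0 := by
  set r := √(2 * v) with hr
  have hr2 : r ^ 2 = 2 * v := Real.sq_sqrt (by linarith)
  have hr0 : 0 ≤ r := Real.sqrt_nonneg _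
  set μ : Measure ℝ := (arcsineLaw v hv : Measure ℝ) with hμdef
  have hμ : μ = intervalDensity r fun x => 1 / (Real.pi * √(2 * v - x ^ 2)) := rfl
  have hi1 := (integrable_one_div_sub μ hz).const_mul z
  have hi2 := (integrable_one_div_sub_pow μ hz 2).const_mul (2 * v - z ^ 2)
  have hi : Integrable (fun x : ℝ => z * (1 / (z - (x : ℂ))) +
      (2 * v - z ^ 2) * (1 / (z - (x : ℂ))) ^ 2) μ := hi1.add hi2
  have e : z * cauchyTransform (arcsineLaw v hv) z +
      (2 * v - z ^ 2) * ∫ x : ℝ, (1 / (z - (x : ℂ))) ^ 2 ∂μ =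
      ∫ x : ℝ, (z * (1 / (z - (x : ℂ))) + (2 * v - z ^ 2) * (1 / (z - (x : ℂ))) ^ 2) ∂μ := by
    rw [integral_add hi1 hi2, integral_const_mul, integral_const_mul]
    rfl
  have hpos : ∀ x ∈ Set.Ioo (-r) r, 0 ≤ 1 / (Real.pi * √(2 * v - x ^ 2)) := fun x _ => by
    positivity
  rw [e, hμ, integral_intervalDensity hr0 (measurable_arcsineDensity v) hpos]
  have hint := intervalIntegrable_of_integrable_intervalDensity hr0 (measurable_arcsineDensity v)
    hpos hi
  have hcont : Continuous fun x : ℝ =>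
      ((√(2 * v - x ^ 2) / Real.pi : ℝ) : ℂ) * (1 / (z - (x : ℂ))) :=
    (Complex.continuous_ofReal.comp (by fun_prop)).mul (continuous_one_div_sub hz)
  rw [intervalIntegral.integral_eq_sub_of_hasDerivAt_of_le (by linarith) hcont.continuousOn ?_ hint]
  · rw [neg_sq, hr2, sub_self]
    simp
  · intro x hx
    have hS2 : 0 < 2 * v - x ^ 2 := sub_sq_pos_of_mem_Ioo hx
    have hS : 0 < √(2 * v - x ^ 2) := Real.sqrt_pos.2 hS2
    have h1 : HasDerivAt (fun x : ℝ => √(2 * v - x ^ 2) / Real.pi)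
        (-(2 * x) / (2 * √(2 * v - x ^ 2)) / Real.pi) x := by
      have h0 : HasDerivAt (fun x : ℝ => 2 * v - x ^ 2) (-(2 * x)) x := by
        simpa using (hasDerivAt_pow 2 x).const_sub (2 * v)
      exact (h0.sqrt hS2.ne').div_const _
    have hne := sub_ofReal_ne_zero hz x
    have h2 : HasDerivAt (fun x : ℝ => 1 / (z - (x : ℂ))) (1 / (z - (x : ℂ)) ^ 2) x := by
      have h3 : HasDerivAt (fun x : ℝ => z - (x : ℂ)) (-1) x := by
        simpa using (Complex.ofRealCLM.hasDerivAt (x := x)).const_sub z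
      simp only [one_div]
      refine (h3.inv hne).congr_deriv ?_
      field_simp
    refine (h1.ofReal_comp.mul h2).congr_deriv ?_
    have hSq : ((√(2 * v - x ^ 2) : ℝ) : ℂ) ^ 2 = 2 * v - x ^ 2 := by
      rw [← Complex.ofReal_pow, Real.sq_sqrt hS2.le]
      push_cast
      ring
    have hSC : ((√(2 * v - x ^ 2) : ℝ) : ℂ) ≠ 0 := by exact_mod_cast hS.ne'
    have hπ : (Real.pi : ℂ) ≠ 0 := by exact_mod_cast Real.pi_ne_zero
    push_cast
    generalize ((√(2 * v - x ^ 2) : ℝ) : ℂ) = S at hSq hSC ⊢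
    field_simp
    rw [hSq]
    ring

lemma hasDerivAt_cauchyTransform (μ : ProbabilityMeasure ℝ) {z : ℂ} (hz : 0 < z.im) :
    HasDerivAt (cauchyTransform μ) (-∫ x : ℝ, (1 / (z - (x : ℂ))) ^ 2 ∂(μ : Measure ℝ)) z := by
  have h := hasDerivAt_integral_one_div_sub_pow (μ : Measure ℝ) hz 0
  have e : cauchyTransform μ =
      fun w => ∫ x : ℝ, (1 / (w - (x : ℂ))) ^ (0 + 1) ∂(μ : Measure ℝ) := by
    funext w
    simp [cauchyTransform]
  rw [e]
  simpa using h

lemma cauchyTransform_arcsineLaw_sq {v : ℝ} (hv : 0 < v) {z : ℂ} (hz : 0 < z.im) :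
    (z ^ 2 - 2 * v) * cauchyTransform (arcsineLaw v hv) z ^ 2 = 1 := by
  set μ := arcsineLaw v hv with hμ
  set g : ℂ → ℂ := fun z => (z ^ 2 - 2 * v) * cauchyTransform μ z ^ 2 with hg
  have hopen : IsOpen {z : ℂ | 0 < z.im} := isOpen_lt continuous_const Complex.continuous_im
  have hconn : IsPreconnected {z : ℂ | 0 < z.im} := (convex_halfSpace_im_gt 0).isPreconnected
  have hd : ∀ z : ℂ, 0 < z.im → HasDerivAt g 0 z := by
    intro z hz
    have h1 := hasDerivAt_cauchyTransform μ hz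
    have h2 : HasDerivAt (fun z : ℂ => z ^ 2 - 2 * v) (2 * z) z := by
      simpa using (hasDerivAt_pow 2 z).sub_const (2 * (v : ℂ))
    refine (h2.mul (h1.pow 2)).congr_deriv ?_
    have h3 := arcsineLaw_ode hv hz
    rw [← hμ] at h3
    simp only [Pi.pow_apply]
    push_cast
    linear_combination 2 * cauchyTransform μ z * h3
  obtain ⟨a, ha⟩ := hopen.exists_is_const_of_deriv_eq_zero hconn
    (fun z hz => (hd z hz).differentiableAt.differentiableWithinAt) (fun z hz => (hd z hz).deriv)
  -- along `i y` with `y → ∞` the constant is seen to be one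
  have him : ∀ n : ℕ, 0 < ((n + 1 : ℝ) * Complex.I).im := fun n => by simp; positivity
  have hnat : Tendsto (fun n : ℕ => ((n : ℝ) + 1)) atTop atTop :=
    tendsto_atTop_add_const_right _ _ tendsto_natCast_atTop_atTop
  have hzG : Tendsto (fun n : ℕ => ((n + 1 : ℝ) * Complex.I) *
      cauchyTransform μ ((n + 1 : ℝ) * Complex.I)) atTop (𝓝 1) := by
    rw [tendsto_iff_norm_sub_tendsto_zero]
    refine squeeze_zero (fun _ => norm_nonneg _) (fun n => ?_) (hnat.const_div_atTop √(2 * v))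
    set w : ℂ := (n + 1 : ℝ) * Complex.I with hw
    have hwim : w.im = n + 1 := by simp [hw]
    have hwpos : 0 < w.im := him n
    have e : w * cauchyTransform μ w - 1 =
        ∫ x : ℝ, (w * (1 / (w - (x : ℂ))) - 1) ∂(μ : Measure ℝ) := by
      rw [integral_sub ((integrable_one_div_sub _ hwpos).const_mul w) (integrable_const _),
        integral_const_mul]
      simp [cauchyTransform]
    rw [e]
    have hb : ∀ᵐ x : ℝ ∂(μ : Measure ℝ), ‖w * (1 / (w - (x : ℂ))) - 1‖ ≤ √(2 * v) / (n + 1) := by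
      have hmem : ∀ᵐ x ∂(μ : Measure ℝ), x ∈ Set.Ioo (-√(2 * v)) √(2 * v) :=
        ae_intervalDensity_mem
      filter_upwards [hmem] with x hx
      have hne := sub_ofReal_ne_zero hwpos x
      have e1 : w * (1 / (w - (x : ℂ))) - 1 = x * (1 / (w - (x : ℂ))) := by
        field_simp; ring
      rw [e1, norm_mul, Complex.norm_real, Real.norm_eq_abs, div_eq_mul_one_div √(2 * v), ← hwim]
      exact mul_le_mul (abs_lt.2 hx).le (norm_one_div_sub_le hwpos x) (norm_nonneg _)
        (Real.sqrt_nonneg _)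
    have := norm_integral_le_of_norm_le_const hb
    simpa using this
  have hz2 : Tendsto (fun n : ℕ => (1 : ℂ) + 2 * v / ((n + 1 : ℝ) : ℂ) ^ 2) atTop (𝓝 (1 + 0)) := by
    refine Tendsto.const_add _ ?_
    have h1 : Tendsto (fun n : ℕ => ((2 * v / ((n : ℝ) + 1) ^ 2 : ℝ) : ℂ)) atTop
        (𝓝 ((0 : ℝ) : ℂ)) :=
      (Complex.continuous_ofReal.tendsto 0).comp
        (Tendsto.const_div_atTop ((tendsto_pow_atTop two_ne_zero).comp hnat) _)
    refine (h1.congr fun n => ?_)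
    push_cast
    rfl
  have hlim : Tendsto (fun n : ℕ => g ((n + 1 : ℝ) * Complex.I)) atTop (𝓝 ((1 + 0) * 1 ^ 2)) := by
    refine (hz2.mul (hzG.pow 2)).congr fun n => ?_
    simp only [hg]
    have hn : ((n + 1 : ℝ) : ℂ) ≠ 0 := by
      have : (n + 1 : ℝ) ≠ 0 := by positivity
      exact_mod_cast this
    generalize ((n + 1 : ℝ) : ℂ) = m at hn ⊢
    rw [mul_pow m Complex.I, mul_pow (m * Complex.I), mul_pow m Complex.I, Complex.I_sq]
    field_simp
    ring
  have hconst : ∀ n : ℕ, g ((n + 1 : ℝ) * Complex.I) = a := fun n => ha _ (him n)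
  have h1 : a = 1 := by
    have := tendsto_nhds_unique (hlim.congr hconst) tendsto_const_nhds
    rw [← this]; ring
  exact (ha z hz).trans h1

lemma recipCauchy_arcsineLaw_sq {v : ℝ} (hv : 0 < v) {z : ℂ} (hz : 0 < z.im) :
    recipCauchy (arcsineLaw v hv) z ^ 2 = z ^ 2 - 2 * v := by
  have h := cauchyTransform_arcsineLaw_sq hv hz
  have h0 := cauchyTransform_ne_zero (arcsineLaw v hv) hz
  rw [recipCauchy, div_pow, one_pow, div_eq_iff (pow_ne_zero 2 h0), h]

lemma eq_of_sq_eq_sq_of_im_pos {a b : ℂ} (h : a ^ 2 = b ^ 2) (ha : 0 < a.im) (hb : 0 < b.im) :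
    a = b := by
  rcases sq_eq_sq_iff_eq_or_eq_neg.1 h with h | h
  · exact h
  · have := congrArg Complex.im h
    rw [Complex.neg_im] at this
    linarith

end Arcsine

section Kesten

/-- The density of the absolutely continuous part of the Kesten distribution. -/
noncomputable def kestenDensity (p q x : ℝ) : ℝ :=
  p * √(4 * q - x ^ 2) / (2 * Real.pi * (p ^ 2 - (p - q) * x ^ 2))

variable {p q : ℝ}

lemma measurable_kestenDensity (p q : ℝ) : Measurable (kestenDensity p q) := by
  unfold kestenDensity
  fun_prop

lemma kestenMeasure_eq (p q : ℝ) : kestenMeasure p q =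
    intervalDensity (2 * √q) (kestenDensity p q) +
      if 2 * q < p then ENNReal.ofReal ((p - 2 * q) / (2 * (p - q))) •
        (Measure.dirac (p / √(p - q)) + Measure.dirac (-(p / √(p - q)))) else 0 := rfl

lemma four_mul_sub_sq_pos (hq : 0 < q) {x : ℝ} (hx : x ∈ Set.Ioo (-(2 * √q)) (2 * √q)) :
    0 < 4 * q - x ^ 2 := by
  have := Real.sq_sqrt hq.le
  nlinarith [hx.1, hx.2]

lemma kestenDensity_denom_pos (hp : 0 < p) {x : ℝ} (hx : 0 < 4 * q - x ^ 2) :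
    0 < p ^ 2 - (p - q) * x ^ 2 := by
  rcases le_or_gt p q with h | h
  · nlinarith [mul_nonneg (sub_nonneg.2 h) (sq_nonneg x), pow_pos hp 2]
  · nlinarith [mul_pos (sub_pos.2 h) hx, sq_nonneg (p - 2 * q)]

lemma kestenDensity_nonneg (hp : 0 < p) (hq : 0 < q) {x : ℝ}
    (hx : x ∈ Set.Ioo (-(2 * √q)) (2 * √q)) : 0 ≤ kestenDensity p q x := by
  have h := kestenDensity_denom_pos hp (four_mul_sub_sq_pos hq hx)
  have := Real.pi_pos
  unfold kestenDensity
  positivity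

lemma hasDerivAt_four_mul_sub_sq (q x : ℝ) :
    HasDerivAt (fun x : ℝ => 4 * q - x ^ 2) (-(2 * x)) x := by
  simpa using (hasDerivAt_pow 2 x).const_sub (4 * q)

lemma hasDerivAt_arcsin_div (hq : 0 < q) {x : ℝ} (hx : x ∈ Set.Ioo (-(2 * √q)) (2 * √q)) :
    HasDerivAt (fun x : ℝ => Real.arcsin (x / (2 * √q))) (1 / √(4 * q - x ^ 2)) x := by
  have hr : 0 < 2 * √q := by positivity
  have hr2 : (2 * √q) ^ 2 = 4 * q := by rw [mul_pow, Real.sq_sqrt hq.le]; ring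
  have h1 : x / (2 * √q) ≠ -1 := fun h => by rw [div_eq_iff hr.ne'] at h; linarith [hx.1]
  have h2 : x / (2 * √q) ≠ 1 := fun h => by rw [div_eq_iff hr.ne'] at h; linarith [hx.2]
  refine ((Real.hasDerivAt_arcsin h1 h2).comp x
    ((hasDerivAt_id x).div_const (2 * √q))).congr_deriv ?_
  have h4 : √(1 - (x / (2 * √q)) ^ 2) = √(4 * q - x ^ 2) / (2 * √q) := by
    rw [show 1 - (x / (2 * √q)) ^ 2 = (4 * q - x ^ 2) / (2 * √q) ^ 2 by
      rw [div_pow, hr2]; field_simp,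
      Real.sqrt_div' _ (sq_nonneg _), Real.sqrt_sq hr.le]
  have h5 := (Real.sqrt_pos.2 (four_mul_sub_sq_pos hq hx)).ne'
  rw [h4]
  field_simp

/-- The mass of the absolutely continuous part for `p = q`, the semicircle law. -/
lemma intervalDensity_kestenDensity_self (hq : 0 < q) :
    intervalDensity (2 * √q) (kestenDensity q q) Set.univ = 1 := by
  have hr : 0 < 2 * √q := by positivity
  have hr2 : (2 * √q) ^ 2 = 4 * q := by rw [mul_pow, Real.sq_sqrt hq.le]; ring
  have hπ := Real.pi_ne_zero
  rw [intervalDensity_univ hr.le (Φ := fun x => 1 / (2 * Real.pi * q) *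
      (x * √(4 * q - x ^ 2) / 2 + 2 * q * Real.arcsin (x / (2 * √q))))
      (by fun_prop) (fun x hx => ?_) fun x hx => kestenDensity_nonneg hq hq hx]
  · simp only [neg_sq, hr2, sub_self, Real.sqrt_zero, neg_div, div_self hr.ne', Real.arcsin_neg,
      Real.arcsin_one]
    rw [ENNReal.ofReal_eq_one]
    field_simp
    ring
  · have hS2 := four_mul_sub_sq_pos hq hx
    have hS := (Real.sqrt_pos.2 hS2).ne'
    refine ((((hasDerivAt_id x).mul ((hasDerivAt_four_mul_sub_sq q x).sqrt hS2.ne')).div_const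
      2).add ((hasDerivAt_arcsin_div hq hx).const_mul (2 * q))).const_mul _ |>.congr_deriv ?_
    have hSq := Real.sq_sqrt hS2.le
    simp only [kestenDensity, id, sub_self, zero_mul, sub_zero]
    generalize √(4 * q - x ^ 2) = S at hS hSq ⊢
    field_simp
    rw [hSq]
    ring

/-- With `S² = 4q - x²` and `D = p² - (p - q) x²`, the argument `u` of this arcsine satisfies
`1 - u² = p² S² / (4 q D)`. -/
lemma hasDerivAt_arcsin_kesten (hp : 0 < p) (hq : 0 < q) {x : ℝ}
    (hx : x ∈ Set.Ioo (-(2 * √q)) (2 * √q)) :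
    HasDerivAt (fun x : ℝ => Real.arcsin ((p - 2 * q) * x /
        (2 * √q * √(p ^ 2 - (p - q) * x ^ 2))))
      ((p - 2 * q) * p / ((p ^ 2 - (p - q) * x ^ 2) * √(4 * q - x ^ 2))) x := by
  have hS2 := four_mul_sub_sq_pos hq hx
  have hS := Real.sqrt_pos.2 hS2
  have hD2 := kestenDensity_denom_pos hp hS2
  have hD := Real.sqrt_pos.2 hD2
  have hSq := Real.sq_sqrt hS2.le
  have hDq := Real.sq_sqrt hD2.le
  have hr : 0 < √q := by positivity
  have hr2 : √q ^ 2 = q := Real.sq_sqrt hq.le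
  have hd : HasDerivAt (fun x : ℝ => p ^ 2 - (p - q) * x ^ 2) (-((p - q) * (2 * x))) x := by
    simpa using ((hasDerivAt_pow 2 x).const_mul (p - q)).const_sub (p ^ 2)
  have hu := ((hasDerivAt_id x).const_mul (p - 2 * q)).div
    ((hd.sqrt hD2.ne').const_mul (2 * √q)) (by positivity)
  set u := (p - 2 * q) * x / (2 * √q * √(p ^ 2 - (p - q) * x ^ 2)) with hudef
  have h1u : 1 - u ^ 2 = (p * √(4 * q - x ^ 2) / (2 * √q * √(p ^ 2 - (p - q) * x ^ 2))) ^ 2 := by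
    rw [hudef, div_pow, div_pow, eq_div_iff (by positivity), sub_mul,
      div_mul_cancel₀ _ (by positivity)]
    rw [mul_pow, mul_pow, mul_pow, mul_pow p, hr2, hDq, hSq]
    ring
  have hpos : 0 < 1 - u ^ 2 := by rw [h1u]; positivity
  have hsq : √(1 - u ^ 2) =
      p * √(4 * q - x ^ 2) / (2 * √q * √(p ^ 2 - (p - q) * x ^ 2)) := by
    rw [h1u, Real.sqrt_sq (by positivity)]
  have hm1 : u ≠ -1 := fun h => by rw [h] at hpos; norm_num at hpos
  have h1 : u ≠ 1 := fun h => by rw [h] at hpos; norm_num at hpos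
  refine ((Real.hasDerivAt_arcsin hm1 h1).comp x hu).congr_deriv ?_
  rw [hsq]
  simp only [id]
  generalize √(4 * q - x ^ 2) = S at *
  have hx2 : (p - q) * x ^ 2 = p ^ 2 - √(p ^ 2 - (p - q) * x ^ 2) ^ 2 := by rw [hDq]; ring
  nth_rewrite 5 [← hDq]
  generalize √(p ^ 2 - (p - q) * x ^ 2) = d at hD hx2 ⊢
  generalize √q = s at hr ⊢
  field_simp
  linear_combination (p - 2 * q) * hx2

/-- The mass of the absolutely continuous part for `p ≠ q`. It is one unless `p > 2q`, when the rest
of the mass sits in the atoms. The density is a combination of `1 / S` and `1 / (D S)`, where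
`S² = 4q - x²` and `D = p² - (p - q) x²`, both of which are derivatives of arcsines. -/
lemma intervalDensity_kestenDensity (hp : 0 < p) (hq : 0 < q) (hpq : p ≠ q) :
    intervalDensity (2 * √q) (kestenDensity p q) Set.univ =
      ENNReal.ofReal ((p - |p - 2 * q|) / (2 * (p - q))) := by
  have hr : 0 < 2 * √q := by positivity
  have hr2 : (2 * √q) ^ 2 = 4 * q := by rw [mul_pow, Real.sq_sqrt hq.le]; ring
  have hπ := Real.pi_ne_zero
  have hpq' : p - q ≠ 0 := sub_ne_zero.2 hpq
  have hend : p ^ 2 - (p - q) * (4 * q) = (p - 2 * q) ^ 2 := by ring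
  -- at the endpoints the second arcsine is `± arcsin (sign (p - 2q))`, also if `p = 2q`
  have harc : (p - 2 * q) * Real.arcsin ((p - 2 * q) * (2 * √q) / (2 * √q * |p - 2 * q|)) =
      |p - 2 * q| * (Real.pi / 2) := by
    rcases lt_trichotomy (p - 2 * q) 0 with h | h | h
    · rw [abs_of_neg h, show (p - 2 * q) * (2 * √q) / (2 * √q * -(p - 2 * q)) = -1 by
        have := h.ne; field_simp, Real.arcsin_neg, Real.arcsin_one]
      ring
    · simp [h]
    · rw [abs_of_pos h, mul_comm (2 * √q), div_self (by positivity), Real.arcsin_one]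
  rw [intervalDensity_univ hr.le (Φ := fun x => 1 / (2 * Real.pi * (p - q)) *
      (p * Real.arcsin (x / (2 * √q)) - (p - 2 * q) * Real.arcsin ((p - 2 * q) * x /
        (2 * √q * √(p ^ 2 - (p - q) * x ^ 2)))))
      ?_ (fun x hx => ?_) fun x hx => kestenDensity_nonneg hp hq hx]
  · congr 1
    simp only [neg_sq, hr2, hend, Real.sqrt_sq_eq_abs, neg_div, div_self hr.ne', Real.arcsin_neg,
      Real.arcsin_one, mul_neg, harc]
    field_simp
    ring
  · rcases eq_or_ne p (2 * q) with h | h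
    · rw [show p - 2 * q = 0 by linarith]
      simp only [zero_mul]
      fun_prop
    · have hD : ∀ x ∈ Set.Icc (-(2 * √q)) (2 * √q), 0 < p ^ 2 - (p - q) * x ^ 2 := by
        intro x hx
        have hx2 : 0 ≤ 4 * q - x ^ 2 := by nlinarith [hx.1, hx.2]
        rcases le_or_gt p q with h' | h'
        · nlinarith [mul_nonneg (sub_nonneg.2 h') (sq_nonneg x), pow_pos hp 2]
        · nlinarith [mul_nonneg (sub_pos.2 h').le hx2, sq_pos_of_ne_zero (sub_ne_zero.2 h)]
      refine continuousOn_const.mul (ContinuousOn.sub (by fun_prop) (continuousOn_const.mul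
        (Real.continuous_arcsin.comp_continuousOn (ContinuousOn.div (by fun_prop) (by fun_prop)
          fun x hx => ?_))))
      have := Real.sqrt_pos.2 (hD x hx)
      positivity
  · have hS2 := four_mul_sub_sq_pos hq hx
    have hS := (Real.sqrt_pos.2 hS2).ne'
    have hD := (kestenDensity_denom_pos hp hS2).ne'
    refine ((((hasDerivAt_arcsin_div hq hx).const_mul p).sub
      ((hasDerivAt_arcsin_kesten hp hq hx).const_mul (p - 2 * q))).const_mul _).congr_deriv ?_
    have hSq := Real.sq_sqrt hS2.le
    simp only [kestenDensity]
    have e : (p - 2 * q) ^ 2 = p ^ 2 - (p - q) * x ^ 2 - (p - q) * √(4 * q - x ^ 2) ^ 2 := by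
      rw [hSq]; ring
    generalize √(4 * q - x ^ 2) = S at *
    generalize p ^ 2 - (p - q) * x ^ 2 = D at *
    field_simp
    linear_combination (-1) * e

theorem isProbabilityMeasure_kestenMeasure (hp : 0 < p) (hq : 0 < q) :
    IsProbabilityMeasure (kestenMeasure p q) := by
  constructor
  rw [kestenMeasure_eq]
  rcases eq_or_ne p q with rfl | hpq
  · rw [if_neg (by linarith), add_zero, intervalDensity_kestenDensity_self hp]
  split_ifs with h
  · have h1 : 0 < p - q := by linarith
    have h2 : 0 < p - 2 * q := by linarith
    simp only [Measure.coe_add, Pi.add_apply, Measure.smul_apply, measure_univ, smul_eq_mul]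
    rw [intervalDensity_kestenDensity hp hq hpq, abs_of_pos h2, one_add_one_eq_two,
      ← ENNReal.ofReal_ofNat 2, ← ENNReal.ofReal_mul (by positivity),
      ← ENNReal.ofReal_add (by apply div_nonneg <;> linarith) (by positivity),
      ENNReal.ofReal_eq_one]
    field_simp
    ring
  · rw [add_zero, intervalDensity_kestenDensity hp hq hpq, abs_of_nonpos (by linarith),
      ENNReal.ofReal_eq_one, div_eq_one_iff_eq (mul_ne_zero two_ne_zero (sub_ne_zero.2 hpq))]
    ring

/-- The Kesten distribution as a bundled probability measure. -/
noncomputable def kestenLaw (p q : ℝ) (hp : 0 < p) (hq : 0 < q) : ProbabilityMeasure ℝ :=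
  ⟨kestenMeasure p q, isProbabilityMeasure_kestenMeasure hp hq⟩

/-- The atoms do not contribute to the integral of a function whose values at them cancel. -/
lemma integral_kestenMeasure (hp : 0 < p) (hq : 0 < q) {f : ℝ → ℂ} (hf : Continuous f)
    (h0 : 2 * q < p → f (p / √(p - q)) + f (-(p / √(p - q))) = 0) :
    ∫ x, f x ∂(kestenMeasure p q) =
      ∫ x in (-(2 * √q))..(2 * √q), (kestenDensity p q x : ℂ) * f x := by
  have := isProbabilityMeasure_kestenMeasure hp hq
  have hfin : IsFiniteMeasure (intervalDensity (2 * √q) (kestenDensity p q)) :=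
    isFiniteMeasure_of_le (kestenMeasure p q) (Measure.le_add_right le_rfl)
  rw [← integral_intervalDensity (by positivity) (measurable_kestenDensity p q)
    (fun x hx => kestenDensity_nonneg hp hq hx), kestenMeasure_eq]
  split_ifs with h
  · have hd : ∀ a : ℝ, Integrable f (Measure.dirac a) := fun a =>
      integrable_dirac (by simp [enorm_lt_top])
    rw [integral_add_measure (integrable_intervalDensity_of_continuous hf)
      (((hd _).add_measure (hd _)).smul_measure ENNReal.ofReal_ne_top),
      integral_smul_measure, integral_add_measure (hd _) (hd _), integral_dirac, integral_dirac,
      h0 h, smul_zero, add_zero]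
  · rw [add_zero]

/-- The weight `p² - (p - q) x²` cancels the denominator of the Kesten density and vanishes at the
atoms, so that the Cauchy transform of the Kesten distribution reduces to that of an arcsine law. -/
lemma cauchyTransform_kestenLaw (hp : 0 < p) (hq : 0 < q) {z : ℂ} (hz : 0 < z.im) :
    (p ^ 2 - (p - q) * z ^ 2) * cauchyTransform (kestenLaw p q hp hq) z =
      (q - p / 2) * z - p / 2 * recipCauchy (arcsineLaw (2 * q) (mul_pos two_pos hq)) z := by
  set a : ℝ → ℂ := fun x => 1 / (z - (x : ℂ)) with ha
  have hac : Continuous a := continuous_one_div_sub hz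
  have hne : ∀ x : ℝ, z - (x : ℂ) ≠ 0 := sub_ofReal_ne_zero hz
  have hr : 2 * √q = √(2 * (2 * q)) := by
    rw [show 2 * (2 * q) = 2 ^ 2 * q by ring, Real.sqrt_mul (by norm_num), Real.sqrt_sq two_pos.le]
  set ν : Measure ℝ := (arcsineLaw (2 * q) (mul_pos two_pos hq) : Measure ℝ) with hν
  have hνeq : ν = intervalDensity (2 * √q) fun x => 1 / (Real.pi * √(2 * (2 * q) - x ^ 2)) := by
    rw [hr]
    rfl
  have hνpos : ∀ x ∈ Set.Ioo (-(2 * √q)) (2 * √q), 0 ≤ 1 / (Real.pi * √(2 * (2 * q) - x ^ 2)) :=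
    fun x _ => by positivity
  have hνfin : IsFiniteMeasure (intervalDensity (2 * √q) fun x =>
      1 / (Real.pi * √(2 * (2 * q) - x ^ 2))) := by rw [← hνeq]; infer_instance
  have := isProbabilityMeasure_kestenMeasure hp hq
  have hia : Integrable a (kestenMeasure p q) := integrable_one_div_sub _ hz
  -- the integrand differs from `(p² - (p - q) z²) / (z - x)` by a constant
  have e1 : (p ^ 2 - (p - q) * z ^ 2) * cauchyTransform (kestenLaw p q hp hq) z =
      ∫ x : ℝ, ((p ^ 2 - (p - q) * (x : ℂ) ^ 2) * a x - (p - q) * x) ∂(kestenMeasure p q) -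
        (p - q) * z := by
    have h1 : ∀ x : ℝ, (p ^ 2 - (p - q) * (x : ℂ) ^ 2) * a x - (p - q) * x =
        (p ^ 2 - (p - q) * z ^ 2) * a x + (p - q) * z := fun x => by
      have := hne x
      simp only [ha]
      field_simp
      ring
    simp_rw [h1]
    rw [integral_add (hia.const_mul _) (integrable_const _), integral_const_mul]
    simp [cauchyTransform, kestenLaw, ha]
  rw [e1, integral_kestenMeasure hp hq (by fun_prop) (fun h => ?_)]
  swap
  · have hpq : 0 < p - q := by linarith
    have h2 : ((p / √(p - q) : ℝ) : ℂ) ^ 2 = p ^ 2 / (p - q) := by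
      rw [← Complex.ofReal_pow, div_pow, Real.sq_sqrt hpq.le]
      push_cast
      rfl
    have hpqC : (p : ℂ) - q ≠ 0 := by exact_mod_cast hpq.ne'
    rw [Complex.ofReal_neg, neg_sq, h2, mul_div_cancel₀ _ hpqC]
    ring
  have heven : ∀ x : ℝ, 1 / (Real.pi * √(2 * (2 * q) - (-x) ^ 2)) =
      1 / (Real.pi * √(2 * (2 * q) - x ^ 2)) := fun x => by rw [neg_sq]
  have hkeven : ∀ x : ℝ, kestenDensity p q (-x) = kestenDensity p q x := fun x => by
    simp only [kestenDensity, neg_sq]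
  have hfin : IsFiniteMeasure (intervalDensity (2 * √q) (kestenDensity p q)) :=
    isFiniteMeasure_of_le (kestenMeasure p q) (Measure.le_add_right le_rfl)
  have hkpos : ∀ x ∈ Set.Ioo (-(2 * √q)) (2 * √q), 0 ≤ kestenDensity p q x :=
    fun x hx => kestenDensity_nonneg hp hq hx
  have hr0 : 0 ≤ 2 * √q := by positivity
  have e2 : ∫ x : ℝ in (-(2 * √q))..(2 * √q), (kestenDensity p q x : ℂ) *
      ((p ^ 2 - (p - q) * (x : ℂ) ^ 2) * a x - (p - q) * x) =
      p / 2 * ((4 * q - z ^ 2) * cauchyTransform (arcsineLaw (2 * q) (mul_pos two_pos hq)) z +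
        z) := by
    rw [← integral_intervalDensity hr0 (measurable_kestenDensity p q) hkpos,
      integral_sub (integrable_intervalDensity_of_continuous (by fun_prop))
        (integrable_intervalDensity_of_continuous (by fun_prop)),
      integral_const_mul,
      integral_id_intervalDensity hr0 (measurable_kestenDensity p q) hkpos hkeven,
      mul_zero, sub_zero]
    have h1 : ∫ x : ℝ, (p ^ 2 - (p - q) * (x : ℂ) ^ 2) * a x
        ∂(intervalDensity (2 * √q) (kestenDensity p q)) =
        ∫ x : ℝ, p / 2 * ((4 * q - (x : ℂ) ^ 2) * a x) ∂ν := by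
      rw [hνeq, integral_intervalDensity hr0 (measurable_kestenDensity p q) hkpos,
        integral_intervalDensity hr0 (measurable_arcsineDensity (2 * q)) hνpos,
        intervalIntegral.integral_of_le (by linarith),
        intervalIntegral.integral_of_le (by linarith),
        integral_Ioc_eq_integral_Ioo, integral_Ioc_eq_integral_Ioo]
      refine setIntegral_congr_fun measurableSet_Ioo fun x hx => ?_
      have hS2 := four_mul_sub_sq_pos hq hx
      have hS : ((√(4 * q - x ^ 2) : ℝ) : ℂ) ≠ 0 := by exact_mod_cast (Real.sqrt_pos.2 hS2).ne'
      have hSq : ((√(4 * q - x ^ 2) : ℝ) : ℂ) ^ 2 = 4 * q - (x : ℂ) ^ 2 := by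
        rw [← Complex.ofReal_pow, Real.sq_sqrt hS2.le]
        push_cast
        ring
      have hD : (p : ℂ) ^ 2 - (p - q) * (x : ℂ) ^ 2 ≠ 0 := by
        exact_mod_cast (kestenDensity_denom_pos hp hS2).ne'
      have hπ : (Real.pi : ℂ) ≠ 0 := by exact_mod_cast Real.pi_ne_zero
      simp only [kestenDensity, show 2 * (2 * q) = 4 * q by ring]
      push_cast
      rw [← hSq]
      field_simp
    have h2 : ∀ x : ℝ, (p : ℂ) / 2 * ((4 * q - (x : ℂ) ^ 2) * a x) =
        p / 2 * ((4 * q - z ^ 2) * a x) + (p / 2 * z + p / 2 * x) := fun x => by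
      have := hne x
      simp only [ha]
      field_simp
      ring
    have hx : Integrable (fun x : ℝ => (p : ℂ) / 2 * x) ν := by
      rw [hνeq]
      exact integrable_intervalDensity_of_continuous (by fun_prop)
    have hx' : Integrable (fun x : ℝ => (p : ℂ) / 2 * z + p / 2 * x) ν :=
      (integrable_const _).add hx
    have hia' : Integrable a ν := integrable_one_div_sub _ hz
    have hmean : ∫ x : ℝ, (x : ℂ) ∂ν = 0 := by
      rw [hνeq]
      exact integral_id_intervalDensity hr0 (measurable_arcsineDensity (2 * q)) hνpos heven
    rw [h1]
    simp_rw [h2]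
    rw [integral_add ((hia'.const_mul _).const_mul _) hx',
      integral_add (integrable_const _) hx, integral_const_mul, integral_const_mul,
      integral_const_mul, integral_const_mul, hmean]
    simp [cauchyTransform, hν, ha]
    ring
  have h3 := recipCauchy_arcsineLaw_sq (mul_pos two_pos hq) hz
  have h4 := cauchyTransform_ne_zero (arcsineLaw (2 * q) (mul_pos two_pos hq)) hz
  rw [e2]
  rw [recipCauchy] at h3 ⊢
  generalize cauchyTransform (arcsineLaw (2 * q) (mul_pos two_pos hq)) z = G at h3 h4 ⊢
  push_cast at h3
  have h5 : 1 / G = (z ^ 2 - 4 * q) * G := by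
    field_simp at h3 ⊢
    linear_combination h3
  rw [h5]
  ring

/-- The Kesten distribution `K_{p,q}` is the `p / 2q`-transform of the arcsine law of variance
`2q`. -/
theorem eq_kestenMeasure_of_isTTransform {p v : ℝ} (hp : 0 < p) (hv : 0 < v)
    {κ : ProbabilityMeasure ℝ} (hκ : IsTTransform (p / v) (arcsineLaw v hv) κ) :
    (κ : Measure ℝ) = kestenMeasure p (v / 2) := by
  have hq : 0 < v / 2 := half_pos hv
  suffices h : κ = kestenLaw p (v / 2) hp hq by rw [h]; rfl
  have hv2 : 2 * (v / 2) = v := by ring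
  -- above the line `Im z = c` the factor `p² - (p - v/2) z²` has no zeros
  obtain ⟨c, hc, hcD⟩ : ∃ c : ℝ, 0 ≤ c ∧ ∀ z : ℂ, c < z.im →
      (p : ℂ) ^ 2 - (p - (v / 2 : ℝ)) * z ^ 2 ≠ 0 := by
    refine ⟨√(p ^ 2 / |p - v / 2|), Real.sqrt_nonneg _, fun z hz h0 => ?_⟩
    have h1 : |p - v / 2| * ‖z‖ ^ 2 = p ^ 2 := by
      have := congrArg norm (sub_eq_zero.1 h0)
      rw [norm_mul, norm_pow, norm_pow, ← Complex.ofReal_sub, Complex.norm_real, Complex.norm_real,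
        Real.norm_eq_abs, Real.norm_eq_abs, sq_abs] at this
      exact this.symm
    have hne : |p - v / 2| ≠ 0 := fun h => by
      rw [h, zero_mul] at h1
      exact (pow_pos hp 2).ne h1
    have h2 : ‖z‖ = √(p ^ 2 / |p - v / 2|) := by
      rw [← h1, mul_div_cancel_left₀ _ hne, Real.sqrt_sq (norm_nonneg _)]
    exact absurd (hz.trans_le ((le_abs_self _).trans (Complex.abs_im_le_norm z))) (by simp [h2])
  refine eq_of_cauchyTransform_eq hc fun z hz => ?_
  have hz0 : 0 < z.im := hc.trans_lt hz
  have h1 := cauchyTransform_kestenLaw hp hq hz0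
  have h2 := hκ z hz0
  have h3 := recipCauchy_arcsineLaw_sq hv hz0
  have h4 := cauchyTransform_ne_zero κ hz0
  simp only [hv2] at h1
  have hD := hcD z hz
  have hvC : (v : ℂ) ≠ 0 := by exact_mod_cast hv.ne'
  generalize recipCauchy (arcsineLaw v hv) z = H at h1 h2 h3
  refine mul_left_cancel₀ hD ?_
  rw [h1]
  rw [recipCauchy, div_eq_iff h4] at h2
  push_cast at h2 ⊢
  have h5 : ((1 - p / v) * z + p / v * H) * ((v / 2 - p / 2) * z - p / 2 * H) =
      (p : ℂ) ^ 2 - (p - v / 2) * z ^ 2 := by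
    field_simp
    linear_combination (-p ^ 2) * h3
  rw [← h5]
  linear_combination (-((v / 2 - p / 2) * z - p / 2 * H)) * h2

end Kesten

/-! ### The two limit theorems -/

section Subfamilies

variable {A : Type*} [CStarAlgebra A]

lemma words_mono {I J : Type*} {𝒜 : I → NonUnitalSubalgebra ℂ A}
    {ℬ : J → NonUnitalSubalgebra ℂ A} (g : J → I) (h : ∀ j, ℬ j ≤ 𝒜 (g j)) :
    words ℬ ≤ words 𝒜 :=
  Submonoid.closure_mono (Set.iUnion_subset fun j _ hx =>
    Set.mem_iUnion.2 ⟨g j, h j hx⟩)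

lemma adjoin_smul_le (c : ℝ) (x : A) :
    NonUnitalAlgebra.adjoin ℂ {c • x} ≤ NonUnitalAlgebra.adjoin ℂ {x} := by
  rw [NonUnitalAlgebra.adjoin_le_iff, Set.singleton_subset_iff]
  rw [← smul_one_smul ℂ c x]
  exact SMulMemClass.smul_mem _ (NonUnitalAlgebra.self_mem_adjoin_singleton ℂ x)

variable [PartialOrder A] {φ ψ : A →ₚ[ℂ] ℂ}

/-- C-monotone independence is inherited by families of subalgebras of a subfamily. -/
lemma IsCMonotoneIndependent.of_le {I J : Type*} [LinearOrder I] [LinearOrder J]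
    {𝒜 : I → NonUnitalSubalgebra ℂ A} (h𝒜 : IsCMonotoneIndependent φ ψ 𝒜)
    {ℬ : J → NonUnitalSubalgebra ℂ A} {g : J → I} (hg : StrictMono g) (h : ∀ j, ℬ j ≤ 𝒜 (g j)) :
    IsCMonotoneIndependent φ ψ ℬ where
  first j k v a y hv ha hy hkj :=
    h𝒜.first _ _ v a y (words_mono g h hv) (h j ha) (h k hy) (hg hkj)
  last i j u x a hu hx ha hij :=
    h𝒜.last _ _ u x a (words_mono g h hu) (h i hx) (h j ha) (hg hij)
  inner i j k u v x a y hu hv hx ha hy hij hkj :=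
    h𝒜.inner _ _ _ u v x a y (words_mono g h hu) (words_mono g h hv) (h i hx) (h j ha) (h k hy)
      (hg hij) (hg hkj)
  monotone :=
    { first := fun j k v a y hv ha hy hkj =>
        h𝒜.monotone.first _ _ v a y (words_mono g h hv) (h j ha) (h k hy) (hg hkj)
      last := fun i j u x a hu hx ha hij =>
        h𝒜.monotone.last _ _ u x a (words_mono g h hu) (h i hx) (h j ha) (hg hij)
      inner := fun i j k u v x a y hu hv hx ha hy hij hkj =>
        h𝒜.monotone.inner _ _ _ u v x a y (words_mono g h hu) (words_mono g h hv) (h i hx)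
          (h j ha) (h k hy) (hg hij) (hg hkj) }

end Subfamilies

lemma IsTTransform.unique {t : ℝ} {μ κ κ' : ProbabilityMeasure ℝ} (h : IsTTransform t μ κ)
    (h' : IsTTransform t μ κ') : κ' = κ :=
  eq_of_recipCauchy_eq fun z hz => (h' z hz).trans (h z hz).symm

section CentralLimit

variable {A : Type*} [CStarAlgebra A] [PartialOrder A] {φ : A →ₚ[ℂ] ℂ}

lemma apply_smul_pow (φ : A →ₚ[ℂ] ℂ) (c : ℝ) (x : selfAdjoint A) (k : ℕ) :
    φ (((c • x : selfAdjoint A) : A) ^ k) = (c ^ k : ℝ) * φ ((x : A) ^ k) := by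
  rw [selfAdjoint.val_smul, smul_pow, PositiveLinearMap.map_smul_of_tower, Complex.real_smul]

lemma isInfinitesimal_smul {X : ℕ → selfAdjoint A} {σ : ℝ} (hid : IdenticallyDistributed φ X)
    (h1 : φ (X 0 : A) = 0) (h2 : φ ((X 0 : A) ^ 2) = (σ : ℂ)) :
    IsInfinitesimal φ (fun (N : ℕ) i => (√(N : ℝ))⁻¹ • X i) 0 σ 0 where
  identicallyDistributed N i j k := by
    simp only [apply_smul_pow, hid i j k]
  first := by simp [h1]
  second := by
    refine tendsto_const_nhds.congr' ?_
    filter_upwards [eventually_gt_atTop 0] with N hN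
    have hN' : (0 : ℝ) < N := Nat.cast_pos.2 hN
    rw [apply_smul_pow, h2, ← Complex.ofReal_mul, Complex.ofReal_re, inv_pow,
      Real.sq_sqrt hN'.le, mul_inv_cancel_left₀ hN'.ne']
  fourth := by
    have h : Tendsto (fun N : ℕ => (φ ((X 0 : A) ^ 4)).re / (N : ℝ)) atTop (𝓝 0) :=
      tendsto_const_div_atTop_nhds_zero_nat _
    refine h.congr' ?_
    filter_upwards [eventually_gt_atTop 0] with N hN
    have hN' : (0 : ℝ) < N := Nat.cast_pos.2 hN
    rw [apply_smul_pow, Complex.re_ofReal_mul, inv_pow,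
      show √(N : ℝ) ^ 4 = N ^ 2 by rw [show 4 = 2 * 2 by rfl, pow_mul, Real.sq_sqrt hN'.le]]
    simp
    field_simp

/-- The square of a flow line of `w ↦ -v / w` is affine in the time, so that the time-one map of the
flow is the square root of `z² - 2v`. -/
lemma eq_arcsineLaw {v : ℝ} (hv : 0 < v) {p : ProbabilityMeasure ℝ}
    (hp : ∀ y : ℝ → ℂ, IsFlowLine (driftField 0 v 0) y → recipCauchy p (y 0) = y 1) :
    p = arcsineLaw v hv := by
  refine eq_of_recipCauchy_eq fun z hz => ?_
  obtain ⟨y, hy0, hy⟩ := exists_isFlowLine_driftField 0 0 hv.le hz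
  refine eq_of_sq_eq_sq_of_im_pos ?_ (im_recipCauchy_pos p hz)
    (im_recipCauchy_pos (arcsineLaw v hv) hz)
  rw [recipCauchy_arcsineLaw_sq hv hz, ← hy0, hp y hy]
  have hd : ∀ t ∈ Set.Icc (0 : ℝ) 1,
      HasDerivWithinAt (fun t => y t ^ 2 + 2 * v * t) 0 (Set.Icc 0 1) t := by
    intro t ht
    have hyt := hy t ht
    have hne : y t ≠ 0 := fun h => by simpa [h] using hyt.1
    have h1 := (hyt.2.pow 2).add
      ((Complex.ofRealCLM.hasDerivAt (x := t)).hasDerivWithinAt.const_mul (2 * (v : ℂ)))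
    refine h1.congr_deriv ?_
    simp [driftField]
    field_simp
    ring
  have h := constant_of_derivWithin_zero (fun t ht => (hd t ht).differentiableWithinAt)
    (fun t ht => (hd t (Set.Ico_subset_Icc_self ht)).derivWithin
      (uniqueDiffOn_Icc zero_lt_one t (Set.Ico_subset_Icc_self ht))) 1
      (Set.right_mem_Icc.2 zero_le_one)
  simp at h
  linear_combination h

end CentralLimit

section Poisson

variable {A : Type*} [CStarAlgebra A] [PartialOrder A] {φ : A →ₚ[ℂ] ℂ}

lemma isInfinitesimal_of_tendsto {X : ℕ → ℕ → selfAdjoint A} {ρ : ℝ}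
    (hid : ∀ N : ℕ, IdenticallyDistributed φ fun n : Fin N => X N n)
    (h : ∀ k : ℕ, 1 ≤ k →
      Tendsto (fun N : ℕ => (N : ℂ) * φ ((X N 0 : A) ^ k)) atTop (𝓝 (ρ : ℂ))) :
    IsInfinitesimal φ X ρ ρ 1 := by
  have hre : ∀ k : ℕ, 1 ≤ k →
      Tendsto (fun N : ℕ => (N : ℝ) * (φ ((X N 0 : A) ^ k)).re) atTop (𝓝 ρ) := fun k hk => by
    refine ((Complex.continuous_re.tendsto _).comp (h k hk)).congr fun N => ?_
    simp
  refine ⟨hid, hre 1 le_rfl, hre 2 one_le_two, ?_⟩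
  have h4 := ((hre 4 (by norm_num)).sub ((hre 3 (by norm_num)).const_mul 2)).add
    (hre 2 one_le_two)
  convert h4 using 2 <;> ring

lemma driftField_self_one (ρ : ℝ) {w : ℂ} (hw : 0 < w.im) :
    driftField ρ ρ 1 w = ρ * w / (1 - w) := by
  have h1 : w - 1 ≠ 0 := fun h => by
    rw [sub_eq_zero] at h
    simp [h] at hw
  have h2 : 1 - w ≠ 0 := fun h => h1 (by linear_combination -h)
  rw [driftField, Complex.ofReal_one]
  field_simp
  ring

/-- Only the flow lines starting at the points of the upper half-plane enter the definition of the
monotone Poisson law; they are the flow lines of the drift field. -/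
lemma isMonotonePoisson_iff {ρ : ℝ} {p : ProbabilityMeasure ℝ} :
    IsMonotonePoisson ρ p ↔ ∀ z : ℂ, 0 < z.im →
      ∃ y : ℝ → ℂ, y 0 = z ∧ IsFlowLine (driftField ρ ρ 1) y ∧ y 1 = recipCauchy p z := by
  have hfield : ∀ y : ℝ → ℂ, IsFlowLine (driftField ρ ρ 1) y ↔ ∀ t ∈ Set.Icc (0 : ℝ) 1,
      0 < (y t).im ∧ HasDerivWithinAt y (ρ * y t / (1 - y t)) (Set.Icc 0 1) t := fun y =>
    forall₂_congr fun t _ => and_congr_right fun h => by rw [driftField_self_one ρ h]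
  simp_rw [hfield]
  constructor
  · rintro ⟨H, hH⟩ z hz
    exact ⟨fun t => H t z, hH z hz⟩
  · intro h
    choose! Y hY using h
    exact ⟨fun t z => Y z t, hY⟩

end Poisson

end CMonotone

theorem mainTheorem5 {A : Type*} [CStarAlgebra A] [PartialOrder A] [StarOrderedRing A]
    (φ ψ : A →ₚ[ℂ] ℂ) (hφ : φ 1 = 1) (hψ : ψ 1 = 1) :
    -- central limit theorem
    (∀ (X : ℕ → selfAdjoint A) (α β : ℝ) (hβ : 0 < β),
      0 ≤ α →
      CMonotone.IdenticallyDistributed φ X → CMonotone.IdenticallyDistributed ψ X →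
      CMonotone.AreCMonotoneIndependent φ ψ X →
      (∀ i, φ (X i : A) = 0) → (∀ i, ψ (X i : A) = 0) →
      (∀ i, φ ((X i : A) ^ 2) = ((α ^ 2 : ℝ) : ℂ)) →
      (∀ i, ψ ((X i : A) ^ 2) = ((β ^ 2 : ℝ) : ℂ)) →
      ∃ κ : ProbabilityMeasure ℝ,
        CMonotone.IsTTransform (α ^ 2 / β ^ 2)
          (CMonotone.arcsineLaw (β ^ 2) (pow_pos hβ 2)) κ ∧
        (∀ κ' : ProbabilityMeasure ℝ,
          CMonotone.IsTTransform (α ^ 2 / β ^ 2)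
            (CMonotone.arcsineLaw (β ^ 2) (pow_pos hβ 2)) κ' → κ' = κ) ∧
        Tendsto
          (fun n : ℕ =>
            (CMonotone.law φ hφ ((√(n : ℝ))⁻¹ • ∑ i ∈ Finset.range n, X i),
             CMonotone.law ψ hψ ((√(n : ℝ))⁻¹ • ∑ i ∈ Finset.range n, X i)))
          atTop (𝓝 (κ, CMonotone.arcsineLaw (β ^ 2) (pow_pos hβ 2))) ∧
        (0 < α → (κ : Measure ℝ) = CMonotone.kestenMeasure (α ^ 2) (β ^ 2 / 2))) ∧
    -- Poisson's law of small numbers; row `N` of the array is `X N 0, …, X N (N - 1)`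
    (∀ (X : ℕ → ℕ → selfAdjoint A) (lam ρ : ℝ),
      0 < lam → 0 < ρ →
      (∀ N : ℕ, CMonotone.IdenticallyDistributed φ fun n : Fin N => X N n) →
      (∀ N : ℕ, CMonotone.IdenticallyDistributed ψ fun n : Fin N => X N n) →
      (∀ N : ℕ, CMonotone.AreCMonotoneIndependent φ ψ fun n : Fin N => X N n) →
      (∀ k : ℕ, 1 ≤ k →
        Tendsto (fun N : ℕ => (N : ℂ) * φ ((X N 0 : A) ^ k)) atTop (𝓝 (lam : ℂ))) →
      (∀ k : ℕ, 1 ≤ k →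
        Tendsto (fun N : ℕ => (N : ℂ) * ψ ((X N 0 : A) ^ k)) atTop (𝓝 (ρ : ℂ))) →
      ∃ p κ : ProbabilityMeasure ℝ,
        CMonotone.IsMonotonePoisson ρ p ∧
        (∀ p' : ProbabilityMeasure ℝ, CMonotone.IsMonotonePoisson ρ p' → p' = p) ∧
        CMonotone.IsTTransform (lam / ρ) p κ ∧
        (∀ κ' : ProbabilityMeasure ℝ, CMonotone.IsTTransform (lam / ρ) p κ' → κ' = κ) ∧
        Tendsto
          (fun N : ℕ =>
            (CMonotone.law φ hφ (∑ n ∈ Finset.range N, X N n),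
             CMonotone.law ψ hψ (∑ n ∈ Finset.range N, X N n)))
          atTop (𝓝 (κ, p))) := by
  open CMonotone in
  constructor
  · intro X α β hβ hα hidφ hidψ hind h1φ h1ψ h2φ h2ψ
    have hβ2 : 0 < β ^ 2 := pow_pos hβ 2
    have ht : 0 ≤ α ^ 2 / β ^ 2 := by positivity
    have hXφ : IsInfinitesimal φ (fun (N : ℕ) i => (√(N : ℝ))⁻¹ • X i) (α ^ 2 / β ^ 2 * 0)
        (α ^ 2 / β ^ 2 * β ^ 2) 0 := by
      rw [mul_zero, div_mul_cancel₀ _ hβ2.ne']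
      exact isInfinitesimal_smul hidφ (h1φ 0) (h2φ 0)
    obtain ⟨p, κ, hp, hκ, hlim⟩ := exists_tendsto_law_sum hφ hψ hXφ
      (isInfinitesimal_smul hidψ (h1ψ 0) (h2ψ 0)) ht hβ2.le fun N =>
        hind.of_le (g := fun n : Fin N => (n : ℕ)) Fin.val_strictMono fun n => by
          rw [generated, selfAdjoint.val_smul]
          exact adjoin_smul_le _ _
    obtain rfl := eq_arcsineLaw hβ2 hp
    simp_rw [← Finset.smul_sum] at hlim
    exact ⟨κ, hκ, fun κ' hκ' => hκ.unique hκ', hlim, fun hα0 =>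
      eq_kestenMeasure_of_isTTransform (pow_pos hα0 2) hβ2 hκ⟩
  · intro X lam ρ hlam hρ hidφ hidψ hind hφX hψX
    have hXφ := isInfinitesimal_of_tendsto hidφ hφX
    have hXψ := isInfinitesimal_of_tendsto hidψ hψX
    rw [← div_mul_cancel₀ lam hρ.ne'] at hXφ
    obtain ⟨p, κ, hp, hκ, hlim⟩ := exists_tendsto_law_sum hφ hψ hXφ hXψ
      (div_nonneg hlam.le hρ.le) hρ.le hind
    refine ⟨p, κ, isMonotonePoisson_iff.2 fun z hz => ?_, fun p' hp' => ?_, hκ,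
      fun κ' hκ' => hκ.unique hκ', hlim⟩
    · obtain ⟨y, hy0, hy⟩ := exists_isFlowLine_driftField ρ 1 hρ.le hz
      exact ⟨y, hy0, hy, by rw [← hy0, hp y hy]⟩
    · refine eq_of_recipCauchy_eq fun z hz => ?_
      obtain ⟨y, hy0, hy, hy1⟩ := isMonotonePoisson_iff.1 hp' z hz
      rw [← hy1, ← hp y hy, hy0]
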